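/- Let $N\ge 1$, let $\Omega\subset\mathbb R^N$ be a bounded open set, let $0<\varepsilon<1$, and let $\overline f,\overline g:\mathbb R^N\setminus\Omega\to\mathbb R$ be Lipschitz functions. Write $B_\varepsilon(x)$ for the open ball of radius $\varepsilon$ centred at $x$. **The game.** A token moves on two copies (boards) of $\mathbb R^N$, starting at a point $x_0\in\Omega$ of board $j_0\in\{1,2\}$. When the token is at $x_n\in\Omega$ in board 1, with probability $1-\varepsilon^2$ a fair coin is tossed and the winner chooses the next position $x_{n+1}\in B_\varepsilon(x_n)$ in board 1; with probability $\varepsilon^2$ the token jumps to $x_n$ in board 2. When it is at $x_n\in\Omega$ in board 2, with probability $1-\varepsilon^2$ the next position is uniformly distributed in $B_\varepsilon(x_n)$ in board 2; with probability $\varepsilon^2$ the token jumps to $x_n$ in board 1. The game ends at the first time $\tau$ with $x_\tau\notin\Omega$, and Player II then pays Player I the amount $h(x_\tau)$, equal to $\overline f(x_\tau)$ in board 1 and to $\overline g(x_\tau)$ in board 2. A strategy $S_{\rm I}$ or $S_{\rm II}$ is a Borel measurable function of the partial histories $((x_0,j_0),\dots,(x_n,j_n))$ giving the point of $B_\varepsilon(x_n)$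 chosen if the player wins the toss. Let $\mathbb E^{(x_0,j_0)}_{S_{\rm I},S_{\rm II}}$ be the expectation for the resulting law on game sequences. **The dynamic programming principle (DPP).** A pair $u,v:\mathbb R^N\to\mathbb R$ solves the DPP if, for every $x\in\Omega$, $u$ is bounded on $B_\varepsilon(x)$, $v$ is integrable on $B_\varepsilon(x)$, and $$u(x)=\varepsilon^2v(x)+(1-\varepsilon^2)\Big\{\tfrac12\sup_{B_\varepsilon(x)}u+\tfrac12\inf_{B_\varepsilon(x)}u\Big\},\qquad v(x)=\varepsilon^2u(x)+(1-\varepsilon^2)\frac1{|B_\varepsilon(x)|}\int_{B_\varepsilon(x)}v(y)\,dy,$$ while $u=\overline f$ and $v=\overline g$ on $\mathbb R^N\setminus\Omega$. A pair is a subsolution if the same holds with $\le$ in place of $=$ in these four equations. **Theorem.** For all strategies and all starting positions in $\Omega$ the game ends almost surely and the payoff is integrable. There is a pair $(u^\varepsilon,v^\varepsilon)$ of functions on $\mathbb R^N$, bounded in $\Omega$, such that: 1. the game has the value $(u^\varepsilon,v^\varepsilon)$: for every $x\in\Omega$, $$u^\varepsilon(x)=\inf_{S_{\rm I}}\sup_{S_{\rm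 II}}\mathbb E^{(x,1)}_{S_{\rm I},S_{\rm II}}[h(x_\tau)]=\sup_{S_{\rm II}}\inf_{S_{\rm I}}\mathbb E^{(x,1)}_{S_{\rm I},S_{\rm II}}[h(x_\tau)]=\sup_{S_{\rm I}}\inf_{S_{\rm II}}\mathbb E^{(x,1)}_{S_{\rm I},S_{\rm II}}[h(x_\tau)]=\inf_{S_{\rm II}}\sup_{S_{\rm I}}\mathbb E^{(x,1)}_{S_{\rm I},S_{\rm II}}[h(x_\tau)],$$ and the same four identities hold for $v^\varepsilon(x)$ with the start $(x,2)$; 2. $(u^\varepsilon,v^\varepsilon)$ solves the DPP, and it is the only solution of the DPP; 3. $(u^\varepsilon,v^\varepsilon)$ is the pointwise largest subsolution of the DPP. -/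

import Mathlib

open MeasureTheory ProbabilityTheory Metric Set

noncomputable section

namespace TwoBoard

/-- Euclidean space `ℝ^N`. -/
abbrev Space (N : ℕ) : Type := EuclideanSpace ℝ (Fin N)

/-- A position of the token: a point of `ℝ^N` together with a board.
Index `0` is the first board (Tug-of-War), index `1` the second board (random walk). -/
abbrev Pos (N : ℕ) : Type := Space N × Fin 2

/-- A history `((x₀, j₀), …, (xₙ, jₙ))` of the first `n + 1` positions. -/
abbrev History (N n : ℕ) : Type := Finset.Iic n → Pos N

/-- The last position `(xₙ, jₙ)` of a history. -/
def History.last {N n : ℕ} (h : History N n) : Pos N := h ⟨n, Finset.mem_Iic.2 le_rfl⟩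

/-- The data of the game: a bounded open set `Ω ⊆ ℝ^N`, a parameter `0 < ε < 1`, and two final
payoff functions, Lipschitz on `ℝ^N \ Ω` (their values inside `Ω` are never used). -/
structure GameData (N : ℕ) where
  Ω : Set (Space N)
  isOpen_Ω : IsOpen Ω
  isBounded_Ω : Bornology.IsBounded Ω
  ε : ℝ
  ε_pos : 0 < ε
  ε_lt_one : ε < 1
  f : Space N → ℝ
  g : Space N → ℝ
  lipschitz_f : ∃ K, LipschitzOnWith K f Ωᶜ
  lipschitz_g : ∃ K, LipschitzOnWith K g Ωᶜ

namespace GameData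

variable {N : ℕ} (G : GameData N)

/-- A (Borel measurable) strategy: after every partial history ending at `xₙ` it prescribes a
point of the open ball `B_ε(xₙ)`, the next position in the first board if the player wins the
coin toss there. (What it prescribes after histories ending in the second board or outside `Ω`
is never used.) -/
structure Strategy where
  move : (n : ℕ) → History N n → Space N
  measurable_move : ∀ n, Measurable (move n)
  move_mem : ∀ n h, move n h ∈ ball h.last.1 G.ε

/-- The one-step transition probability from the position `p`, when the points chosen by the two
players are `y₁` and `y₂`. Outside `Ω` the game is over and the token does not move any more. -/
def step (p : Pos N) (y₁ y₂ : Space N) : Measure (Pos N) :=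
  open Classical in
  if p.1 ∈ G.Ω then
    if p.2 = 0 then
      ENNReal.ofReal ((1 - G.ε ^ 2) / 2) • Measure.dirac (y₁, 0)
        + ENNReal.ofReal ((1 - G.ε ^ 2) / 2) • Measure.dirac (y₂, 0)
        + ENNReal.ofReal (G.ε ^ 2) • Measure.dirac (p.1, 1)
    else
      ENNReal.ofReal (1 - G.ε ^ 2) • (cond volume (ball p.1 G.ε)).map (fun y => (y, 1))
        + ENNReal.ofReal (G.ε ^ 2) • Measure.dirac (p.1, 0)
  else Measure.dirac p

theorem sq_le_one : G.ε ^ 2 ≤ 1 := by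
  have h1 := G.ε_pos
  have h2 := G.ε_lt_one
  nlinarith

theorem measurable_uniform (r : ℝ) :
    Measurable (fun x : Space N => cond volume (ball x r)) := by
  refine Measure.measurable_of_measurable_coe _ fun s hs => ?_
  have key : ∀ t : Set (Space N), MeasurableSet t →
      Measurable (fun x : Space N => volume (ball x r ∩ t)) := fun t ht => by
    have hT : MeasurableSet {q : Space N × Space N | dist q.2 q.1 < r ∧ q.2 ∈ t} :=
      (measurableSet_lt (f := fun q : Space N × Space N => dist q.2 q.1) (g := fun _ => r)
        (by fun_prop) (by fun_prop)).inter (measurable_snd ht)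
    exact measurable_measure_prodMk_left hT
  have h1 : Measurable (fun x : Space N => volume (ball x r)) := by
    simpa using key univ MeasurableSet.univ
  simp only [cond_apply measurableSet_ball]
  exact h1.inv.mul (key s hs)

theorem measurable_step :
    Measurable (fun q : Pos N × Space N × Space N => G.step q.1 q.2.1 q.2.2) := by
  classical
  unfold step
  refine Measurable.ite (G.isOpen_Ω.measurableSet.preimage (by fun_prop)) ?_
    (Measure.measurable_dirac.comp (by fun_prop))
  refine Measurable.ite ((measurableSet_singleton (0 : Fin 2)).preimage
    (f := fun q : Pos N × Space N × Space N => q.1.2) (by fun_prop)) ?_ ?_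
  · refine Measure.measurable_of_measurable_coe _ fun s hs => ?_
    have hd : ∀ φ : Pos N × Space N × Space N → Pos N, Measurable φ →
        Measurable (fun q => Measure.dirac (φ q) s) := fun φ hφ =>
      (Measure.measurable_coe hs).comp (Measure.measurable_dirac.comp hφ)
    simp only [Measure.add_apply, Measure.smul_apply, smul_eq_mul]
    exact (((hd _ (by fun_prop)).const_mul _).add ((hd _ (by fun_prop)).const_mul _)).add
      ((hd _ (by fun_prop)).const_mul _)
  · refine Measure.measurable_of_measurable_coe _ fun s hs => ?_
    simp only [Measure.add_apply, Measure.smul_apply, smul_eq_mul]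
    refine Measurable.add (Measurable.const_mul ?_ _) (Measurable.const_mul ?_ _)
    · exact (Measure.measurable_coe hs).comp ((Measure.measurable_map _ (by fun_prop)).comp
        ((measurable_uniform G.ε).comp (by fun_prop)))
    · exact (Measure.measurable_coe hs).comp (Measure.measurable_dirac.comp (by fun_prop))

theorem isProbabilityMeasure_step (p : Pos N) (y₁ y₂ : Space N) :
    IsProbabilityMeasure (G.step p y₁ y₂) := by
  have h1 := G.sq_le_one
  have h2 := sq_nonneg G.ε
  unfold step
  split_ifs with hΩ hp
  · constructor
    simp only [Measure.add_apply, Measure.smul_apply, smul_eq_mul, measure_univ, mul_one]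
    rw [← ENNReal.ofReal_add (by linarith) (by linarith),
      ← ENNReal.ofReal_add (by linarith) h2, ← ENNReal.ofReal_one]
    congr 1
    ring
  · have : IsProbabilityMeasure (cond (volume : Measure (Space N)) (ball p.1 G.ε)) :=
      cond_isProbabilityMeasure_of_finite (measure_ball_pos _ _ G.ε_pos).ne'
        measure_ball_lt_top.ne
    have : IsProbabilityMeasure ((cond (volume : Measure (Space N)) (ball p.1 G.ε)).map
        (fun y => ((y, 1) : Pos N))) :=
      Measure.isProbabilityMeasure_map (by fun_prop)
    constructor
    simp only [Measure.add_apply, Measure.smul_apply, smul_eq_mul, measure_univ, mul_one]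
    rw [← ENNReal.ofReal_add (by linarith) h2, ← ENNReal.ofReal_one]
    congr 1
    ring
  · infer_instance

/-- The conditional law of the next position given the history, under a pair of strategies. -/
def transition (S₁ S₂ : G.Strategy) (n : ℕ) : Kernel (History N n) (Pos N) where
  toFun h := G.step h.last (S₁.move n h) (S₂.move n h)
  measurable' := by
    have hl : Measurable (fun h : History N n => h.last) := measurable_pi_apply _
    exact G.measurable_step.comp
      (hl.prodMk ((S₁.measurable_move n).prodMk (S₂.measurable_move n)))

instance (S₁ S₂ : G.Strategy) (n : ℕ) : IsMarkovKernel (G.transition S₁ S₂ n) :=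
  ⟨fun _ => G.isProbabilityMeasure_step _ _ _⟩

/-- The law of the game sequence `((x₀, j₀), (x₁, j₁), …)` started at `p`, under the strategies
`S₁` of Player I and `S₂` of Player II. -/
def law (S₁ S₂ : G.Strategy) (p : Pos N) : Measure (ℕ → Pos N) :=
  Kernel.traj (X := fun _ => Pos N) (G.transition S₁ S₂) 0 (fun _ => p)

/-- The token leaves `Ω` after finitely many plays. -/
def Ends (ω : ℕ → Pos N) : Prop := ∃ n, (ω n).1 ∉ G.Ω

/-- The final payoff `h`: `f` in the first board and `g` in the second one. -/
def terminal (p : Pos N) : ℝ := if p.2 = 0 then G.f p.1 else G.g p.1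

/-- The payoff of a game sequence, `h (x_τ)` with `τ` the first exit time from `Ω`
(and `0` if the token never leaves `Ω`). -/
def payoff (ω : ℕ → Pos N) : ℝ :=
  open Classical in
  if h : G.Ends ω then G.terminal (ω (Nat.find h)) else 0

/-- The expected payoff. -/
def expectedPayoff (S₁ S₂ : G.Strategy) (p : Pos N) : ℝ :=
  ∫ ω, G.payoff ω ∂(G.law S₁ S₂ p)

/-- `inf` over the strategies of Player I of `sup` over those of Player II. -/
def infSupI (p : Pos N) : EReal :=
  ⨅ S₁ : G.Strategy, ⨆ S₂ : G.Strategy, (G.expectedPayoff S₁ S₂ p : EReal)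

/-- `sup` over the strategies of Player II of `inf` over those of Player I. -/
def supInfII (p : Pos N) : EReal :=
  ⨆ S₂ : G.Strategy, ⨅ S₁ : G.Strategy, (G.expectedPayoff S₁ S₂ p : EReal)

/-- `sup` over the strategies of Player I of `inf` over those of Player II. -/
def supInfI (p : Pos N) : EReal :=
  ⨆ S₁ : G.Strategy, ⨅ S₂ : G.Strategy, (G.expectedPayoff S₁ S₂ p : EReal)

/-- `inf` over the strategies of Player II of `sup` over those of Player I. -/
def infSupII (p : Pos N) : EReal :=
  ⨅ S₂ : G.Strategy, ⨆ S₁ : G.Strategy, (G.expectedPayoff S₁ S₂ p : EReal)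

/-- The game started at `p` has value `a`, whichever of the two players is the maximizer. -/
def HasValueAt (p : Pos N) (a : ℝ) : Prop :=
  G.infSupI p = a ∧ G.supInfII p = a ∧ G.supInfI p = a ∧ G.infSupII p = a

/-- The right-hand sides of the dynamic programming principle are meaningful (finite suprema
and infima, convergent integrals) at every point of `Ω`. -/
def Admissible (u v : Space N → ℝ) : Prop :=
  ∀ x ∈ G.Ω, BddAbove (u '' ball x G.ε) ∧ BddBelow (u '' ball x G.ε) ∧
    IntegrableOn v (ball x G.ε)

/-- The right-hand side of the first equation of the dynamic programming principle. -/
def rhs₁ (u v : Space N → ℝ) (x : Space N) : ℝ :=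
  G.ε ^ 2 * v x + (1 - G.ε ^ 2) *
    (1 / 2 * sSup (u '' ball x G.ε) + 1 / 2 * sInf (u '' ball x G.ε))

/-- The right-hand side of the second equation of the dynamic programming principle. -/
def rhs₂ (u v : Space N → ℝ) (x : Space N) : ℝ :=
  G.ε ^ 2 * u x + (1 - G.ε ^ 2) * ⨍ y in ball x G.ε, v y

/-- `(u, v)` solves the dynamic programming principle with exterior data `f`, `g`. -/
structure IsSolution (u v : Space N → ℝ) : Prop where
  admissible : G.Admissible u v
  eq₁ : ∀ x ∈ G.Ω, u x = G.rhs₁ u v x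
  eq₂ : ∀ x ∈ G.Ω, v x = G.rhs₂ u v x
  ext₁ : ∀ x ∉ G.Ω, u x = G.f x
  ext₂ : ∀ x ∉ G.Ω, v x = G.g x

/-- `(z, w)` is a subsolution of the dynamic programming principle. -/
structure IsSubsolution (z w : Space N → ℝ) : Prop where
  admissible : G.Admissible z w
  le₁ : ∀ x ∈ G.Ω, z x ≤ G.rhs₁ z w x
  le₂ : ∀ x ∈ G.Ω, w x ≤ G.rhs₂ z w x
  ext₁ : ∀ x ∉ G.Ω, z x ≤ G.f x
  ext₂ : ∀ x ∉ G.Ω, w x ≤ G.g x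

end GameData

end TwoBoard

end

/-!
The whole proof rests on one contraction. On the first board the token jumps to the second one
with probability `ε ^ 2` whatever the players do, and on the second board the random walk
leaves the bounded set `Ω`. Quantitatively, there is a weight, a constant `A` on the first board
and `W x = A - exp (l x₁)` with large `l` on the second one, that one round of the game multiplies
by at most some `θ < 1` (`exists_barrier`). Consequently the right-hand sides of the dynamic
programming principle contract weighted one-sided differences by `θ` (`Barrier.rhs_sub_le`).

Three facts follow. The iterates of the dynamic programming operator converge uniformly to a
solution, which is Borel measurable (`Barrier.exists_isSolution`). A subsolution is bounded above,
the averages in the second equation being controlled by an integral over `Ω`, and hence lies below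
every solution (`IsSubsolution.le_solution`); this gives uniqueness and maximality. Finally the
expectation of the weight of the position decays like `θ ^ n`, so the game ends almost surely
(`Barrier.ae_ends`).

For the value of the game, the supremum of an arbitrary function over an *open* ball is a lower
semicontinuous function of the centre and can be computed from a countable set of points. So there
are measurable strategies maximizing (or minimizing) the solution up to an error `δ / 2 ^ (n + 1)`
in round `n` (`exists_nearMaximizing`). Against any opponent, the solution evaluated along the
game is then a submartingale (supermartingale) up to a total error `δ`, and it converges to the
payoff; by dominated convergence the strategy guarantees the value up to `δ`
(`Barrier.hasValueAt`). As the roles of the players in the transition probabilities are symmetric,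
these two estimates give all four identities for the value.
-/

noncomputable section

namespace TwoBoard

namespace GameData

open Filter Topology

variable {N : ℕ}

/-! ### Averages over balls -/

theorem setAverage_eq_integral_cond (s : Set (Space N)) (f : Space N → ℝ) :
    ⨍ y in s, f y = ∫ y, f y ∂(cond volume s) := by
  rw [setAverage_eq']
  rfl

theorem setAverage_le_setAverage {s : Set (Space N)} (hs : MeasurableSet s) {f g : Space N → ℝ}
    (hf : IntegrableOn f s) (hg : IntegrableOn g s) (h : ∀ y ∈ s, f y ≤ g y) :
    ⨍ y in s, f y ≤ ⨍ y in s, g y := by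
  rw [setAverage_eq, setAverage_eq, smul_eq_mul, smul_eq_mul]
  exact mul_le_mul_of_nonneg_left (setIntegral_mono_on hf hg hs h)
    (inv_nonneg.2 measureReal_nonneg)

theorem setAverage_add_const_mul {s : Set (Space N)} {f g : Space N → ℝ} (c : ℝ)
    (hf : IntegrableOn f s) (hg : IntegrableOn g s) :
    ⨍ y in s, (f y + c * g y) = (⨍ y in s, f y) + c * ⨍ y in s, g y := by
  simp only [setAverage_eq, smul_eq_mul]
  rw [integral_add hf (hg.const_mul c), integral_const_mul]
  ring

theorem integrableOn_ball_of_continuous {f : Space N → ℝ} (hf : Continuous f) (x : Space N)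
    (r : ℝ) : IntegrableOn f (ball x r) :=
  (hf.continuousOn.integrableOn_compact (isCompact_closedBall x r)).mono_set ball_subset_closedBall

/-- The average of `exp (l yᵢ)` over a ball exceeds the value at the centre by a factor that tends
to infinity with `l`: a fixed fraction of the ball lies at least `r / 2` above
the centre in the `i`-th coordinate. -/
theorem exp_le_setAverage_exp (i : Fin N) {r : ℝ} (hr : 0 < r) {l : ℝ} (hl : 0 ≤ l)
    (x : Space N) :
    (1 / 4) ^ N * Real.exp (l * (r / 2)) * Real.exp (l * x i)
      ≤ ⨍ y in ball x r, Real.exp (l * y i) := by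
  set z : Space N := x + EuclideanSpace.single i (3 / 4 * r) with hz
  have hsub : ball z (r / 4) ⊆ ball x r := by
    refine ball_subset_ball' ?_
    have : dist z x = 3 / 4 * r := by
      rw [hz, dist_eq_norm, add_sub_cancel_left, PiLp.norm_single, Real.norm_eq_abs,
        abs_of_pos (by positivity)]
    linarith
  have hvol : volume.real (ball z (r / 4)) = (1 / 4) ^ N * volume.real (ball x r) := by
    have h1 := Measure.addHaar_ball_of_pos (volume : Measure (Space N)) z
      (show 0 < r / 4 by positivity)
    have h2 := Measure.addHaar_ball_of_pos (volume : Measure (Space N)) x hr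
    rw [finrank_euclideanSpace_fin] at h1 h2
    rw [measureReal_def, measureReal_def, h1, h2, ENNReal.toReal_mul, ENNReal.toReal_mul,
      ENNReal.toReal_ofReal (by positivity), ENNReal.toReal_ofReal (by positivity),
      ← mul_assoc, ← mul_pow]
    congr 2
    ring
  have hpos : 0 < volume.real (ball x r) :=
    ENNReal.toReal_pos (measure_ball_pos _ _ hr).ne' measure_ball_lt_top.ne
  have hint : IntegrableOn (fun y : Space N => Real.exp (l * y i)) (ball x r) :=
    integrableOn_ball_of_continuous (by fun_prop) x r
  have hlow : ∀ y ∈ ball z (r / 4),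
      Real.exp (l * (r / 2)) * Real.exp (l * x i) ≤ Real.exp (l * y i) := by
    intro y hy
    rw [← Real.exp_add, Real.exp_le_exp]
    have h1 : |(y - z) i| ≤ ‖y - z‖ := by
      simpa [Real.norm_eq_abs] using PiLp.norm_apply_le (y - z) i
    have h2 : ‖y - z‖ < r / 4 := by simpa [dist_eq_norm] using hy
    have h3 : (y - z) i = y i - (x i + 3 / 4 * r) := by simp [hz]
    rw [h3] at h1
    have h4 := (abs_le.1 h1).1
    nlinarith
  have h1 : Real.exp (l * (r / 2)) * Real.exp (l * x i) * volume.real (ball z (r / 4))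
      ≤ ∫ y in ball z (r / 4), Real.exp (l * y i) := by
    have := setIntegral_mono_on (f := fun _ : Space N => Real.exp (l * (r / 2)) *
      Real.exp (l * x i)) (integrableOn_const measure_ball_lt_top.ne) (hint.mono_set hsub)
      measurableSet_ball hlow
    rwa [setIntegral_const, smul_eq_mul, mul_comm] at this
  have h2 : ∫ y in ball z (r / 4), Real.exp (l * y i) ≤ ∫ y in ball x r, Real.exp (l * y i) :=
    setIntegral_mono_set hint (ae_of_all _ fun y => (Real.exp_pos _).le)
      (LE.le.eventuallyLE hsub)
  rw [setAverage_eq, smul_eq_mul, ← div_eq_inv_mul, le_div_iff₀ hpos]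
  calc _ = Real.exp (l * (r / 2)) * Real.exp (l * x i) * volume.real (ball z (r / 4)) := by
        rw [hvol]; ring
    _ ≤ _ := h1.trans h2

/-! ### The weight that makes the dynamic programming operator a contraction -/

variable (G : GameData N)

theorem one_sub_sq_pos : 0 < 1 - G.ε ^ 2 := by
  nlinarith [G.ε_pos, G.ε_lt_one]

/-- A weight on the two boards, equal to the constant `A` on the first board and to `W` on the
second one, which one round of the game multiplies by at most `θ < 1` at the points of `Ω`,
whatever the players do. The ball `B_R(0)` contains every position the token can reach; the weight
is at least `1` there. -/
structure Barrier where
  R : ℝ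
  A : ℝ
  θ : ℝ
  W : Space N → ℝ
  continuous_W : Continuous W
  ball_subset : ∀ x ∈ G.Ω, ball x G.ε ⊆ ball 0 R
  one_le : ∀ x ∈ ball 0 R, 1 ≤ W x
  le_A : ∀ x, W x ≤ A
  one_le_A : 1 ≤ A
  θ_nonneg : 0 ≤ θ
  θ_lt_one : θ < 1
  tug_le : ∀ x ∈ G.Ω, G.ε ^ 2 * W x + (1 - G.ε ^ 2) * A ≤ θ * A
  walk_le : ∀ x ∈ G.Ω, G.ε ^ 2 * A + (1 - G.ε ^ 2) * ⨍ y in ball x G.ε, W y ≤ θ * W x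

/-- On the second board `W = A - exp (l x₁)`: for large `l` the average of the exponential over
`B_ε(x)` is so much larger than its value at `x` that it outweighs the gain from a jump to the
first board. -/
theorem exists_barrier (hN : 1 ≤ N) : Nonempty G.Barrier := by
  have hε := G.ε_pos
  have hq := G.one_sub_sq_pos
  have hsq : 0 < G.ε ^ 2 := by positivity
  obtain ⟨R, hR0, hR⟩ := G.isBounded_Ω.subset_ball_lt 0 0
  let i : Fin N := ⟨0, hN⟩
  -- `l` is chosen so that the factor in `exp_le_setAverage_exp` is `B / 4 ^ N = 2 / (1 - ε ^ 2)`
  set B : ℝ := 2 * 4 ^ N / (1 - G.ε ^ 2) with hB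
  have hB1 : 1 ≤ B := by
    rw [hB, le_div_iff₀ hq]
    have : (1 : ℝ) ≤ 4 ^ N := one_le_pow₀ (by norm_num)
    linarith
  set l : ℝ := 2 / G.ε * Real.log B with hl
  have hl0 : 0 ≤ l := mul_nonneg (by positivity) (Real.log_nonneg hB1)
  have hexp : Real.exp (l * (G.ε / 2)) = B := by
    rw [show l * (G.ε / 2) = Real.log B by rw [hl]; field_simp, Real.exp_log (by linarith)]
  set R' : ℝ := R + G.ε with hR'
  have hR'0 : 0 < R' := by positivity
  set A : ℝ := 1 + Real.exp (l * R') with hA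
  set m : ℝ := Real.exp (-(l * R')) with hm
  have hm0 : 0 < m := Real.exp_pos _
  have hm1 : m ≤ 1 := Real.exp_le_one_iff.2 (by nlinarith)
  have hA1 : 1 ≤ A := by have := Real.exp_pos (l * R'); linarith
  have hcoord : ∀ x ∈ ball (0 : Space N) R', -(l * R') ≤ l * x i ∧ l * x i ≤ l * R' := by
    intro x hx
    have h1 : |x i| ≤ ‖x‖ := by simpa [Real.norm_eq_abs] using PiLp.norm_apply_le x i
    have h2 : ‖x‖ < R' := by simpa using hx
    obtain ⟨h3, h4⟩ := abs_le.1 (h1.trans h2.le)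
    constructor <;> nlinarith
  have hΩ : ∀ x ∈ G.Ω, x ∈ ball (0 : Space N) R' := fun x hx =>
    ball_subset_ball (by linarith) (hR hx)
  have hχ : ∀ x ∈ G.Ω, m ≤ Real.exp (l * x i) := fun x hx =>
    Real.exp_le_exp.2 (hcoord x (hΩ x hx)).1
  have hεm : G.ε ^ 2 * m ≤ m := by nlinarith
  refine ⟨{
    R := R'
    A := A
    θ := 1 - G.ε ^ 2 * m / A
    W := fun x => A - Real.exp (l * x i)
    continuous_W := by fun_prop
    ball_subset := ?_
    one_le := ?_
    le_A := fun x => ?_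
    one_le_A := hA1
    θ_nonneg := ?_
    θ_lt_one := ?_
    tug_le := ?_
    walk_le := ?_ }⟩
  · intro x hx
    refine ball_subset_ball' ?_
    have : dist x 0 < R := hR hx
    linarith
  · intro x hx
    have := Real.exp_le_exp.2 (hcoord x hx).2
    linarith
  · linarith [Real.exp_pos (l * x i)]
  · rw [sub_nonneg, div_le_one (by linarith)]
    linarith
  · have : 0 < G.ε ^ 2 * m / A := by positivity
    linarith
  · intro x hx
    have h1 : (1 - G.ε ^ 2 * m / A) * A = A - G.ε ^ 2 * m := by field_simp
    nlinarith [hχ x hx]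
  · intro x hx
    have h1 : ⨍ y in ball x G.ε, (A - Real.exp (l * y i))
        = A - ⨍ y in ball x G.ε, Real.exp (l * y i) := by
      have h2 := setAverage_add_const_mul (s := ball x G.ε) (f := fun _ : Space N => A)
        (g := fun y => Real.exp (l * y i)) (-1) (integrableOn_const measure_ball_lt_top.ne)
        (integrableOn_ball_of_continuous (by fun_prop) x G.ε)
      rw [setAverage_const (measure_ball_pos _ _ hε).ne' measure_ball_lt_top.ne] at h2
      simpa [← sub_eq_add_neg] using h2
    have h3 := exp_le_setAverage_exp i hε hl0 x
    have h4 : 2 * Real.exp (l * x i)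
        ≤ (1 - G.ε ^ 2) * ⨍ y in ball x G.ε, Real.exp (l * y i) := by
      refine le_trans (le_of_eq ?_) (mul_le_mul_of_nonneg_left h3 hq.le)
      rw [hexp, hB, one_div, inv_pow]
      field_simp
    have h5 : (1 - G.ε ^ 2 * m / A) * (A - Real.exp (l * x i))
        = A - G.ε ^ 2 * m - Real.exp (l * x i) + G.ε ^ 2 * m / A * Real.exp (l * x i) := by
      field_simp
      ring
    have h6 : 0 ≤ G.ε ^ 2 * m / A * Real.exp (l * x i) := by positivity
    have h7 := hχ x hx
    rw [h1, h5]
    linarith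

variable {G}

namespace Barrier

theorem mem_ball (b : G.Barrier) {x : Space N} (hx : x ∈ G.Ω) : x ∈ ball (0 : Space N) b.R :=
  b.ball_subset x hx (mem_ball_self G.ε_pos)

theorem integrableOn_W (b : G.Barrier) (x : Space N) : IntegrableOn b.W (ball x G.ε) :=
  integrableOn_ball_of_continuous b.continuous_W x G.ε

/-- One application of the right-hand sides of the dynamic programming principle contracts
one-sided weighted differences by `θ`. -/
theorem rhs_sub_le (b : G.Barrier) {u v u' v' : Space N → ℝ} (h : G.Admissible u v)
    (h' : G.Admissible u' v') {c : ℝ} (hc : 0 ≤ c)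
    (hu : ∀ x ∈ G.Ω, u x ≤ u' x + c * b.A) (hu' : ∀ x ∉ G.Ω, u x ≤ u' x)
    (hv : ∀ x ∈ G.Ω, v x ≤ v' x + c * b.W x) (hv' : ∀ x ∉ G.Ω, v x ≤ v' x)
    {x : Space N} (hx : x ∈ G.Ω) :
    G.rhs₁ u v x ≤ G.rhs₁ u' v' x + b.θ * c * b.A ∧
      G.rhs₂ u v x ≤ G.rhs₂ u' v' x + b.θ * c * b.W x := by
  have hq := G.one_sub_sq_pos
  have hA : 0 ≤ b.A := by linarith [b.one_le_A]
  have hne : (ball x G.ε).Nonempty := ⟨x, mem_ball_self G.ε_pos⟩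
  have hu1 : ∀ y, u y ≤ u' y + c * b.A := fun y => by
    by_cases hy : y ∈ G.Ω
    · exact hu y hy
    · have := hu' y hy
      have := mul_nonneg hc hA
      linarith
  have hv1 : ∀ y ∈ ball x G.ε, v y ≤ v' y + c * b.W y := fun y hyx => by
    by_cases hy : y ∈ G.Ω
    · exact hv y hy
    · have := hv' y hy
      have := mul_nonneg hc (zero_le_one.trans (b.one_le y (b.ball_subset x hx hyx)))
      linarith
  obtain ⟨-, hb, hi⟩ := h x hx
  obtain ⟨hb', -, hi'⟩ := h' x hx
  have hsup : sSup (u '' ball x G.ε) ≤ sSup (u' '' ball x G.ε) + c * b.A := by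
    refine csSup_le (hne.image u) ?_
    rintro _ ⟨y, hy, rfl⟩
    linarith [hu1 y, le_csSup hb' (mem_image_of_mem u' hy)]
  have hinf : sInf (u '' ball x G.ε) - c * b.A ≤ sInf (u' '' ball x G.ε) := by
    refine le_csInf (hne.image u') ?_
    rintro _ ⟨y, hy, rfl⟩
    linarith [hu1 y, csInf_le hb (mem_image_of_mem u hy)]
  have havg : ⨍ y in ball x G.ε, v y
      ≤ (⨍ y in ball x G.ε, v' y) + c * ⨍ y in ball x G.ε, b.W y := by
    rw [← setAverage_add_const_mul c hi' (b.integrableOn_W x)]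
    exact setAverage_le_setAverage measurableSet_ball hi
      (hi'.add ((b.integrableOn_W x).const_mul c)) hv1
  have ht := mul_le_mul_of_nonneg_left (b.tug_le x hx) hc
  have hw := mul_le_mul_of_nonneg_left (b.walk_le x hx) hc
  have hsq := sq_nonneg G.ε
  constructor
  · have h1 := mul_le_mul_of_nonneg_left (hv x hx) hsq
    have h2 := mul_le_mul_of_nonneg_left hsup hq.le
    have h3 := mul_le_mul_of_nonneg_left hinf hq.le
    simp only [rhs₁]
    linarith
  · have h1 := mul_le_mul_of_nonneg_left (hu x hx) hsq
    have h2 := mul_le_mul_of_nonneg_left havg hq.le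
    simp only [rhs₂]
    linarith

/-- Iterating `rhs_sub_le`, a one-sided difference bounded by `c` times the weight is bounded by
`θ ^ n c` times the weight for every `n`. -/
theorem le_of_le_rhs (b : G.Barrier) {z w u v : Space N → ℝ} (h : G.Admissible z w)
    (h' : G.Admissible u v)
    (hz : ∀ x ∈ G.Ω, z x ≤ G.rhs₁ z w x) (hw : ∀ x ∈ G.Ω, w x ≤ G.rhs₂ z w x)
    (hu : ∀ x ∈ G.Ω, G.rhs₁ u v x ≤ u x) (hv : ∀ x ∈ G.Ω, G.rhs₂ u v x ≤ v x)
    (hzu : ∀ x ∉ G.Ω, z x ≤ u x) (hwv : ∀ x ∉ G.Ω, w x ≤ v x)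
    (hbdd : ∃ C, ∀ x ∈ G.Ω, z x ≤ u x + C ∧ w x ≤ v x + C) :
    (∀ x, z x ≤ u x) ∧ ∀ x, w x ≤ v x := by
  obtain ⟨C, hC⟩ := hbdd
  set c := max C 0
  have hc : 0 ≤ c := le_max_right _ _
  have key : ∀ n : ℕ, ∀ x ∈ G.Ω, z x ≤ u x + b.θ ^ n * c * b.A ∧
      w x ≤ v x + b.θ ^ n * c * b.W x := by
    intro n
    induction n with
    | zero =>
      intro x hx
      have h1 : C ≤ c := le_max_left _ _
      have h2 := mul_le_mul_of_nonneg_left b.one_le_A hc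
      have h3 := mul_le_mul_of_nonneg_left (b.one_le x (b.mem_ball hx)) hc
      obtain ⟨h4, h5⟩ := hC x hx
      constructor <;> linarith
    | succ n ih =>
      intro x hx
      obtain ⟨h1, h2⟩ := b.rhs_sub_le h h' (mul_nonneg (pow_nonneg b.θ_nonneg n) hc)
        (fun y hy => (ih y hy).1) hzu (fun y hy => (ih y hy).2) hwv hx
      have e : b.θ ^ (n + 1) * c = b.θ * (b.θ ^ n * c) := by ring
      rw [e]
      exact ⟨by linarith [hz x hx, hu x hx], by linarith [hw x hx, hv x hx]⟩
  have hlim : ∀ a d : ℝ, Tendsto (fun n : ℕ => a + b.θ ^ n * c * d) atTop (𝓝 a) := by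
    intro a d
    simpa using (((tendsto_pow_atTop_nhds_zero_of_lt_one b.θ_nonneg b.θ_lt_one).mul_const
      c).mul_const d).const_add a
  constructor
  · intro x
    by_cases hx : x ∈ G.Ω
    · exact ge_of_tendsto' (hlim _ _) fun n => (key n x hx).1
    · exact hzu x hx
  · intro x
    by_cases hx : x ∈ G.Ω
    · exact ge_of_tendsto' (hlim _ _) fun n => (key n x hx).2
    · exact hwv x hx

end Barrier

theorem Barrier.abs_rhs_sub_le (b : G.Barrier) {u v u' v' : Space N → ℝ} (h : G.Admissible u v)
    (h' : G.Admissible u' v') {c : ℝ} (hc : 0 ≤ c) (hu : ∀ x ∈ G.Ω, |u x - u' x| ≤ c * b.A)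
    (hu' : ∀ x ∉ G.Ω, u x = u' x) (hv : ∀ x ∈ G.Ω, |v x - v' x| ≤ c * b.W x)
    (hv' : ∀ x ∉ G.Ω, v x = v' x) {x : Space N} (hx : x ∈ G.Ω) :
    |G.rhs₁ u v x - G.rhs₁ u' v' x| ≤ b.θ * c * b.A ∧
      |G.rhs₂ u v x - G.rhs₂ u' v' x| ≤ b.θ * c * b.W x := by
  have h1 := b.rhs_sub_le h h' hc (fun y hy => by linarith [(abs_le.1 (hu y hy)).2])
    (fun y hy => (hu' y hy).le) (fun y hy => by linarith [(abs_le.1 (hv y hy)).2])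
    (fun y hy => (hv' y hy).le) hx
  have h2 := b.rhs_sub_le h' h hc (fun y hy => by linarith [(abs_le.1 (hu y hy)).1])
    (fun y hy => (hu' y hy).ge) (fun y hy => by linarith [(abs_le.1 (hv y hy)).1])
    (fun y hy => (hv' y hy).ge) hx
  exact ⟨abs_le.2 ⟨by linarith [h2.1], by linarith [h1.1]⟩,
    abs_le.2 ⟨by linarith [h2.2], by linarith [h1.2]⟩⟩

/-! ### Boundedness of subsolutions and uniqueness -/

variable (G) in
theorem exists_finite_cover :
    ∃ t ⊆ G.Ω, t.Finite ∧ G.Ω ⊆ ⋃ x ∈ t, ball x G.ε := by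
  obtain ⟨t, ht, hf, hc⟩ := totallyBounded_iff_subset.1
    (G.isBounded_Ω.isCompact_closure.totallyBounded.subset subset_closure) _
    (dist_mem_uniformity G.ε_pos)
  exact ⟨t, ht, hf, hc⟩

theorem Admissible.bddAbove {u v : Space N → ℝ} (h : G.Admissible u v) :
    ∃ C, ∀ x ∈ G.Ω, u x ≤ C := by
  obtain ⟨t, ht, hf, hc⟩ := G.exists_finite_cover
  obtain ⟨C, hC⟩ := (hf.bddAbove_biUnion (S := fun x => u '' ball x G.ε)).2
    fun x hx => (h x (ht hx)).1
  refine ⟨C, fun x hx => hC ?_⟩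
  obtain ⟨y, hy, hxy⟩ := mem_iUnion₂.1 (hc hx)
  exact mem_iUnion₂.2 ⟨y, hy, mem_image_of_mem u hxy⟩

theorem Admissible.bddBelow {u v : Space N → ℝ} (h : G.Admissible u v) :
    ∃ C, ∀ x ∈ G.Ω, C ≤ u x := by
  obtain ⟨t, ht, hf, hc⟩ := G.exists_finite_cover
  obtain ⟨C, hC⟩ := (hf.bddBelow_biUnion (S := fun x => u '' ball x G.ε)).2
    fun x hx => (h x (ht hx)).2.1
  refine ⟨C, fun x hx => hC ?_⟩
  obtain ⟨y, hy, hxy⟩ := mem_iUnion₂.1 (hc hx)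
  exact mem_iUnion₂.2 ⟨y, hy, mem_image_of_mem u hxy⟩

theorem integrableOn_of_forall_ball {w : Space N → ℝ}
    (h : ∀ x ∈ G.Ω, IntegrableOn w (ball x G.ε)) : IntegrableOn w G.Ω := by
  obtain ⟨t, ht, hf, hc⟩ := G.exists_finite_cover
  exact ((integrableOn_finite_biUnion hf).2 fun x hx => h x (ht hx)).mono_set hc

variable (G) in
theorem exists_bound_payoff (r : ℝ) :
    ∃ C, ∀ x ∈ ball (0 : Space N) r, x ∉ G.Ω → |G.f x| ≤ C ∧ |G.g x| ≤ C := by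
  obtain ⟨K, hf⟩ := G.lipschitz_f
  obtain ⟨L, hg⟩ := G.lipschitz_g
  have hc : IsCompact (closedBall (0 : Space N) r ∩ G.Ωᶜ) :=
    (isCompact_closedBall 0 r).inter_right G.isOpen_Ω.isClosed_compl
  obtain ⟨C, hC⟩ := hc.exists_bound_of_continuousOn (hf.continuousOn.mono inter_subset_right)
  obtain ⟨D, hD⟩ := hc.exists_bound_of_continuousOn (hg.continuousOn.mono inter_subset_right)
  exact ⟨max C D, fun x hx hxΩ =>
    ⟨(hC x ⟨ball_subset_closedBall hx, hxΩ⟩).trans (le_max_left _ _),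
      (hD x ⟨ball_subset_closedBall hx, hxΩ⟩).trans (le_max_right _ _)⟩⟩

/-- A function dominated by its averages is bounded above: the averages over balls of radius `ε`
are controlled by the integral over `Ω`. -/
theorem Barrier.bddAbove_of_le_setAverage (b : G.Barrier) {w : Space N → ℝ} {C a : ℝ}
    (hi : ∀ x ∈ G.Ω, IntegrableOn w (ball x G.ε))
    (hext : ∀ x ∈ ball (0 : Space N) b.R, x ∉ G.Ω → w x ≤ C)
    (hw : ∀ x ∈ G.Ω, w x ≤ a + (1 - G.ε ^ 2) * ⨍ y in ball x G.ε, w y) :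
    ∃ C', ∀ x ∈ G.Ω, w x ≤ C' := by
  have hΩ : IntegrableOn (fun y => |w y|) G.Ω := (integrableOn_of_forall_ball hi).abs
  set J : Space N → ℝ := G.Ω.indicator fun y => |w y| with hJ
  have hJi : Integrable J := (integrable_indicator_iff G.isOpen_Ω.measurableSet).2 hΩ
  have hJ0 : ∀ y, 0 ≤ J y := fun y => indicator_nonneg (fun _ _ => abs_nonneg _) _
  set V : ℝ := volume.real (ball (0 : Space N) G.ε) with hV
  refine ⟨a + (1 - G.ε ^ 2) * (V⁻¹ * (∫ y, J y) + |C|), fun x hx => (hw x hx).trans ?_⟩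
  have hVx : volume.real (ball x G.ε) = V := Measure.addHaar_real_ball_center _ x _
  have hle : ∀ y ∈ ball x G.ε, w y ≤ |C| + 1 * J y := by
    intro y hy
    by_cases hyΩ : y ∈ G.Ω
    · have : J y = |w y| := indicator_of_mem hyΩ _
      have := le_abs_self (w y)
      have := abs_nonneg C
      linarith
    · have := hext y (b.ball_subset x hx hy) hyΩ
      have := le_abs_self C
      have := hJ0 y
      linarith
  have hconst : IntegrableOn (fun _ : Space N => |C|) (ball x G.ε) :=
    integrableOn_const measure_ball_lt_top.ne
  have h1 := setAverage_le_setAverage measurableSet_ball (hi x hx)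
    (hconst.add (hJi.integrableOn.const_mul 1)) hle
  have h2 := setAverage_add_const_mul (s := ball x G.ε) 1 hconst hJi.integrableOn
  rw [setAverage_const (measure_ball_pos _ _ G.ε_pos).ne' measure_ball_lt_top.ne, one_mul,
    setAverage_eq volume J, hVx, smul_eq_mul] at h2
  have h3 : ∫ y in ball x G.ε, J y ≤ ∫ y, J y := setIntegral_le_integral hJi (ae_of_all _ hJ0)
  have h4 : V⁻¹ * ∫ y in ball x G.ε, J y ≤ V⁻¹ * ∫ y, J y :=
    mul_le_mul_of_nonneg_left h3 (inv_nonneg.2 measureReal_nonneg)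
  have h5 := mul_le_mul_of_nonneg_left (h1.trans (h2.le)) G.one_sub_sq_pos.le
  have h6 := mul_le_mul_of_nonneg_left h4 G.one_sub_sq_pos.le
  linarith

theorem IsSubsolution.bddAbove (b : G.Barrier) {z w : Space N → ℝ} (h : G.IsSubsolution z w) :
    ∃ C, ∀ x ∈ G.Ω, z x ≤ C ∧ w x ≤ C := by
  obtain ⟨C, hC⟩ := h.admissible.bddAbove
  obtain ⟨D, hD⟩ := G.exists_bound_payoff b.R
  obtain ⟨C', hC'⟩ := b.bddAbove_of_le_setAverage (a := G.ε ^ 2 * C)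
    (fun x hx => (h.admissible x hx).2.2)
    (fun x hx hxΩ => (h.ext₂ x hxΩ).trans ((le_abs_self _).trans (hD x hx hxΩ).2))
    (fun x hx => (h.le₂ x hx).trans
      (add_le_add_left (mul_le_mul_of_nonneg_left (hC x hx) (sq_nonneg _)) _))
  exact ⟨max C C', fun x hx => ⟨(hC x hx).trans (le_max_left _ _),
    (hC' x hx).trans (le_max_right _ _)⟩⟩

theorem IsSolution.isSubsolution {u v : Space N → ℝ} (h : G.IsSolution u v) :
    G.IsSubsolution u v where
  admissible := h.admissible
  le₁ x hx := (h.eq₁ x hx).le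
  le₂ x hx := (h.eq₂ x hx).le
  ext₁ x hx := (h.ext₁ x hx).le
  ext₂ x hx := (h.ext₂ x hx).le

theorem IsSolution.bddBelow (b : G.Barrier) {u v : Space N → ℝ} (h : G.IsSolution u v) :
    ∃ C, ∀ x ∈ G.Ω, C ≤ u x ∧ C ≤ v x := by
  obtain ⟨C, hC⟩ := h.admissible.bddBelow
  obtain ⟨D, hD⟩ := G.exists_bound_payoff b.R
  obtain ⟨C', hC'⟩ := b.bddAbove_of_le_setAverage (w := fun x => -v x) (a := -(G.ε ^ 2 * C))
    (fun x hx => (h.admissible x hx).2.2.neg)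
    (fun x hx hxΩ => by
      rw [h.ext₂ x hxΩ]
      exact (neg_le_abs _).trans (hD x hx hxΩ).2)
    (fun x hx => by
      have h1 := h.eq₂ x hx
      have h2 := mul_le_mul_of_nonneg_left (hC x hx) (sq_nonneg G.ε)
      have h3 : ⨍ y in ball x G.ε, -v y = -⨍ y in ball x G.ε, v y := integral_neg _
      rw [h3]
      simp only [rhs₂] at h1
      linarith)
  exact ⟨min C (-C'), fun x hx => ⟨(min_le_left _ _).trans (hC x hx),
    (min_le_right _ _).trans (by linarith [hC' x hx])⟩⟩

/-- Comparison principle: a subsolution lies below every solution. -/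
theorem IsSubsolution.le_solution (b : G.Barrier) {z w u v : Space N → ℝ}
    (h : G.IsSubsolution z w) (h' : G.IsSolution u v) : (∀ x, z x ≤ u x) ∧ ∀ x, w x ≤ v x := by
  obtain ⟨C, hC⟩ := h.bddAbove b
  obtain ⟨D, hD⟩ := h'.bddBelow b
  refine b.le_of_le_rhs h.admissible h'.admissible h.le₁ h.le₂ (fun x hx => (h'.eq₁ x hx).ge)
    (fun x hx => (h'.eq₂ x hx).ge) (fun x hx => ?_) (fun x hx => ?_)
    ⟨C - D, fun x hx => ⟨by linarith [(hC x hx).1, (hD x hx).1],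
      by linarith [(hC x hx).2, (hD x hx).2]⟩⟩
  · rw [h'.ext₁ x hx]
    exact h.ext₁ x hx
  · rw [h'.ext₂ x hx]
    exact h.ext₂ x hx

/-! ### Measurability of the operators in the dynamic programming principle -/

theorem sInf_image_eq (u : Space N → ℝ) (s : Set (Space N)) :
    sInf (u '' s) = -sSup ((fun y => -u y) '' s) := by
  rw [Real.sInf_def, ← image_neg_eq_neg, image_image]

theorem bddAbove_neg_image {u : Space N → ℝ} {s : Set (Space N)} (h : BddBelow (u '' s)) :
    BddAbove ((fun y => -u y) '' s) := by
  have h1 := h.neg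
  rwa [← image_neg_eq_neg, image_image] at h1

/-- The supremum over an *open* ball is a lower semicontinuous function of the centre, whatever
the function is. -/
theorem measurable_restrict_sSup {u : Space N → ℝ}
    (hu : ∀ x ∈ G.Ω, BddAbove (u '' ball x G.ε)) :
    Measurable (G.Ω.domRestrict fun x => sSup (u '' ball x G.ε)) := by
  refine measurable_of_Ioi fun a => ?_
  have h : G.Ω.domRestrict (fun x => sSup (u '' ball x G.ε)) ⁻¹' Ioi a =
      Subtype.val ⁻¹' ⋃ y ∈ {y | a < u y}, ball y G.ε := by
    ext ⟨x, hx⟩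
    simp only [mem_preimage, domRestrict_apply, mem_Ioi, mem_iUnion₂, mem_ofPred_eq, exists_prop]
    rw [lt_csSup_iff (hu x hx) (Nonempty.image u ⟨x, mem_ball_self G.ε_pos⟩)]
    constructor
    · rintro ⟨_, ⟨y, hy, rfl⟩, hay⟩
      exact ⟨y, hay, mem_ball_comm.1 hy⟩
    · rintro ⟨y, hay, hy⟩
      exact ⟨u y, ⟨y, mem_ball_comm.1 hy, rfl⟩, hay⟩
  rw [h]
  exact ((isOpen_biUnion fun _ _ => isOpen_ball).preimage continuous_subtype_val).measurableSet

theorem measurable_restrict_sInf {u : Space N → ℝ}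
    (hu : ∀ x ∈ G.Ω, BddBelow (u '' ball x G.ε)) :
    Measurable (G.Ω.domRestrict fun x => sInf (u '' ball x G.ε)) := by
  have h := (measurable_restrict_sSup fun x hx => bddAbove_neg_image (hu x hx)).neg
  convert h using 1
  ext x
  exact sInf_image_eq u _

variable (G) in
theorem isProbabilityMeasure_uniform (x : Space N) :
    IsProbabilityMeasure (cond (volume : Measure (Space N)) (ball x G.ε)) :=
  cond_isProbabilityMeasure_of_finite (measure_ball_pos _ _ G.ε_pos).ne' measure_ball_lt_top.ne

variable (G) in
theorem measurable_setAverage {v : Space N → ℝ} (hv : Measurable v) :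
    Measurable fun x => ⨍ y in ball x G.ε, v y := by
  simp only [setAverage_eq_integral_cond]
  let κ : Kernel (Space N) (Space N) := ⟨fun x => cond volume (ball x G.ε), measurable_uniform _⟩
  have : IsMarkovKernel κ := ⟨G.isProbabilityMeasure_uniform⟩
  exact (hv.stronglyMeasurable.integral_kernel (κ := κ)).measurable

/-! ### Existence of a solution -/

variable (G) in
/-- Measurable functions, bounded in `Ω`, with the exterior data `f`, `g`. -/
structure IsRegular (u v : Space N → ℝ) : Prop where
  measurable₁ : Measurable u
  measurable₂ : Measurable v
  ext₁ : ∀ x ∉ G.Ω, u x = G.f x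
  ext₂ : ∀ x ∉ G.Ω, v x = G.g x
  bounded : ∃ C, ∀ x ∈ G.Ω, |u x| ≤ C ∧ |v x| ≤ C

theorem IsRegular.exists_bound {u v : Space N → ℝ} (h : G.IsRegular u v) (r : ℝ) :
    ∃ C, ∀ x ∈ ball (0 : Space N) r, |u x| ≤ C ∧ |v x| ≤ C := by
  obtain ⟨C, hC⟩ := h.bounded
  obtain ⟨D, hD⟩ := G.exists_bound_payoff r
  refine ⟨max C D, fun x hx => ?_⟩
  by_cases hxΩ : x ∈ G.Ω
  · exact ⟨(hC x hxΩ).1.trans (le_max_left _ _), (hC x hxΩ).2.trans (le_max_left _ _)⟩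
  · rw [h.ext₁ x hxΩ, h.ext₂ x hxΩ]
    exact ⟨(hD x hx hxΩ).1.trans (le_max_right _ _), (hD x hx hxΩ).2.trans (le_max_right _ _)⟩

theorem IsRegular.admissible (b : G.Barrier) {u v : Space N → ℝ} (h : G.IsRegular u v) :
    G.Admissible u v := by
  intro x hx
  obtain ⟨C, hC⟩ := h.exists_bound b.R
  refine ⟨⟨C, ?_⟩, ⟨-C, ?_⟩, ?_⟩
  · rintro _ ⟨y, hy, rfl⟩
    exact (abs_le.1 (hC y (b.ball_subset x hx hy)).1).2
  · rintro _ ⟨y, hy, rfl⟩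
    exact (abs_le.1 (hC y (b.ball_subset x hx hy)).1).1
  · refine Measure.integrableOn_of_bounded (M := C) measure_ball_lt_top.ne
      h.measurable₂.aestronglyMeasurable ?_
    exact (ae_restrict_iff' measurableSet_ball).2 (ae_of_all _ fun y hy =>
      (hC y (b.ball_subset x hx hy)).2)

variable (G) in
open Classical in
/-- The dynamic programming operator: the right-hand sides of the principle in `Ω`, the exterior
data elsewhere. -/
def dppMap (q : (Space N → ℝ) × (Space N → ℝ)) : (Space N → ℝ) × (Space N → ℝ) :=
  (fun x => if x ∈ G.Ω then G.rhs₁ q.1 q.2 x else G.f x,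
    fun x => if x ∈ G.Ω then G.rhs₂ q.1 q.2 x else G.g x)

theorem measurable_of_restrict_of_lipschitzOnWith {u φ : Space N → ℝ}
    (hu : Measurable (G.Ω.domRestrict u)) (hφ : ∃ K, LipschitzOnWith K φ G.Ωᶜ)
    (h : ∀ x ∉ G.Ω, u x = φ x) : Measurable u := by
  obtain ⟨K, hK⟩ := hφ
  refine measurable_of_restrict_of_restrict_compl G.isOpen_Ω.measurableSet hu ?_
  have h1 : G.Ωᶜ.domRestrict u = G.Ωᶜ.domRestrict φ := by
    ext ⟨x, hx⟩
    exact h x hx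
  rw [h1]
  exact hK.continuousOn.domRestrict.measurable

theorem IsRegular.dppMap (b : G.Barrier) {q : (Space N → ℝ) × (Space N → ℝ)}
    (h : G.IsRegular q.1 q.2) : G.IsRegular (G.dppMap q).1 (G.dppMap q).2 := by
  have ha := h.admissible b
  have e₁ : ∀ x ∈ G.Ω, (G.dppMap q).1 x = G.rhs₁ q.1 q.2 x := fun x hx => if_pos hx
  have e₂ : ∀ x ∈ G.Ω, (G.dppMap q).2 x = G.rhs₂ q.1 q.2 x := fun x hx => if_pos hx
  have o₁ : ∀ x ∉ G.Ω, (G.dppMap q).1 x = G.f x := fun x hx => if_neg hx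
  have o₂ : ∀ x ∉ G.Ω, (G.dppMap q).2 x = G.g x := fun x hx => if_neg hx
  have hq := G.one_sub_sq_pos
  have hsq := sq_nonneg G.ε
  refine ⟨?_, ?_, o₁, o₂, ?_⟩
  · refine measurable_of_restrict_of_lipschitzOnWith ?_ G.lipschitz_f o₁
    have h1 : G.Ω.domRestrict (G.dppMap q).1 = fun x : G.Ω => G.ε ^ 2 * q.2 x + (1 - G.ε ^ 2) *
        (1 / 2 * G.Ω.domRestrict (fun x => sSup (q.1 '' ball x G.ε)) x
          + 1 / 2 * G.Ω.domRestrict (fun x => sInf (q.1 '' ball x G.ε)) x) := by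
      ext ⟨x, hx⟩
      exact e₁ x hx
    rw [h1]
    have h2 := measurable_restrict_sSup fun x hx => (ha x hx).1
    have h3 := measurable_restrict_sInf fun x hx => (ha x hx).2.1
    have h4 := h.measurable₂.comp (measurable_subtype_coe (p := (· ∈ G.Ω)))
    exact (h4.const_mul _).add (((h2.const_mul _).add (h3.const_mul _)).const_mul _)
  · refine measurable_of_restrict_of_lipschitzOnWith ?_ G.lipschitz_g o₂
    have h1 : G.Ω.domRestrict (G.dppMap q).2 = fun x : G.Ω => G.rhs₂ q.1 q.2 x := by
      ext ⟨x, hx⟩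
      exact e₂ x hx
    rw [h1]
    have h2 : Measurable (G.rhs₂ q.1 q.2) :=
      (h.measurable₁.const_mul _).add ((G.measurable_setAverage h.measurable₂).const_mul _)
    exact h2.comp measurable_subtype_coe
  · obtain ⟨C, hC⟩ := h.exists_bound b.R
    refine ⟨C, fun x hx => ?_⟩
    have hne : (ball x G.ε).Nonempty := ⟨x, mem_ball_self G.ε_pos⟩
    have hx' := b.mem_ball hx
    have hC' := fun y hy => hC y (b.ball_subset x hx hy)
    have h1 : sSup (q.1 '' ball x G.ε) ≤ C := csSup_le (hne.image _) (by
      rintro _ ⟨y, hy, rfl⟩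
      exact (abs_le.1 (hC' y hy).1).2)
    have h2 : -C ≤ sInf (q.1 '' ball x G.ε) := le_csInf (hne.image _) (by
      rintro _ ⟨y, hy, rfl⟩
      exact (abs_le.1 (hC' y hy).1).1)
    have h3 : sInf (q.1 '' ball x G.ε) ≤ sSup (q.1 '' ball x G.ε) :=
      csInf_le_csSup (hne.image _) (ha x hx).2.1 (ha x hx).1
    have hcst : ∀ a : ℝ, IntegrableOn (fun _ : Space N => a) (ball x G.ε) := fun a =>
      integrableOn_const measure_ball_lt_top.ne
    have h4 := setAverage_le_setAverage measurableSet_ball (ha x hx).2.2 (hcst C)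
      fun y hy => (abs_le.1 (hC' y hy).2).2
    have h5 := setAverage_le_setAverage measurableSet_ball (hcst (-C)) (ha x hx).2.2
      fun y hy => (abs_le.1 (hC' y hy).2).1
    rw [setAverage_const (measure_ball_pos _ _ G.ε_pos).ne' measure_ball_lt_top.ne] at h4 h5
    obtain ⟨a1, a2⟩ := abs_le.1 (hC x hx').1
    obtain ⟨a3, a4⟩ := abs_le.1 (hC x hx').2
    rw [e₁ x hx, e₂ x hx, abs_le, abs_le]
    simp only [rhs₁, rhs₂]
    refine ⟨⟨?_, ?_⟩, ?_, ?_⟩ <;> nlinarith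

variable (G) in
open Classical in
theorem exists_isRegular : ∃ q : (Space N → ℝ) × (Space N → ℝ), G.IsRegular q.1 q.2 := by
  refine ⟨(fun x => if x ∈ G.Ω then 0 else G.f x, fun x => if x ∈ G.Ω then 0 else G.g x),
    ?_, ?_, fun x hx => if_neg hx, fun x hx => if_neg hx, 0, fun x hx => by simp [hx]⟩
  · refine measurable_of_restrict_of_lipschitzOnWith ?_ G.lipschitz_f fun x hx => if_neg hx
    have h : G.Ω.domRestrict (fun x => if x ∈ G.Ω then 0 else G.f x) = fun _ => 0 := by
      ext ⟨x, hx⟩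
      simp [hx]
    rw [h]
    exact measurable_const
  · refine measurable_of_restrict_of_lipschitzOnWith ?_ G.lipschitz_g fun x hx => if_neg hx
    have h : G.Ω.domRestrict (fun x => if x ∈ G.Ω then 0 else G.g x) = fun _ => 0 := by
      ext ⟨x, hx⟩
      simp [hx]
    rw [h]
    exact measurable_const

/-- The iterates of `dppMap` converge uniformly, at a geometric rate, to a solution. -/
theorem Barrier.exists_isSolution (b : G.Barrier) :
    ∃ u v : Space N → ℝ, G.IsRegular u v ∧ G.IsSolution u v := by
  obtain ⟨q₀, hq₀⟩ := G.exists_isRegular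
  set q : ℕ → (Space N → ℝ) × (Space N → ℝ) := fun n => G.dppMap^[n] q₀ with hq
  have hsucc : ∀ n, q (n + 1) = G.dppMap (q n) := fun n => Function.iterate_succ_apply' _ _ _
  have hreg : ∀ n, G.IsRegular (q n).1 (q n).2 := by
    intro n
    induction n with
    | zero => exact hq₀
    | succ n ih =>
      rw [hsucc]
      exact ih.dppMap b
  have hadm := fun n => (hreg n).admissible b
  have e₁ : ∀ n, ∀ x ∈ G.Ω, (q (n + 1)).1 x = G.rhs₁ (q n).1 (q n).2 x := fun n x hx => by
    rw [hsucc]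
    exact if_pos hx
  have e₂ : ∀ n, ∀ x ∈ G.Ω, (q (n + 1)).2 x = G.rhs₂ (q n).1 (q n).2 x := fun n x hx => by
    rw [hsucc]
    exact if_pos hx
  have o₁ : ∀ n m, ∀ x ∉ G.Ω, (q n).1 x = (q m).1 x := fun n m x hx => by
    rw [(hreg n).ext₁ x hx, (hreg m).ext₁ x hx]
  have o₂ : ∀ n m, ∀ x ∉ G.Ω, (q n).2 x = (q m).2 x := fun n m x hx => by
    rw [(hreg n).ext₂ x hx, (hreg m).ext₂ x hx]
  have hθ := b.θ_nonneg
  have hA1 := b.one_le_A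
  obtain ⟨c, hc, hstep⟩ : ∃ c : ℝ, 0 ≤ c ∧ ∀ n, ∀ x ∈ G.Ω,
      |(q (n + 1)).1 x - (q n).1 x| ≤ b.θ ^ n * c * b.A ∧
        |(q (n + 1)).2 x - (q n).2 x| ≤ b.θ ^ n * c * b.W x := by
    obtain ⟨C, hC⟩ := (hreg 0).bounded
    obtain ⟨D, hD⟩ := (hreg 1).bounded
    have hc : 0 ≤ |C| + |D| := by positivity
    refine ⟨|C| + |D|, hc, fun n => ?_⟩
    induction n with
    | zero =>
      intro x hx
      have h1 := hC x hx
      have h2 := hD x hx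
      have h3 := le_abs_self C
      have h4 := le_abs_self D
      have h5 := mul_le_mul_of_nonneg_left hA1 hc
      have h6 := mul_le_mul_of_nonneg_left (b.one_le x (b.mem_ball hx)) hc
      have h7 := abs_sub ((q (0 + 1)).1 x) ((q 0).1 x)
      have h8 := abs_sub ((q (0 + 1)).2 x) ((q 0).2 x)
      simp only [zero_add] at h7 h8 ⊢
      constructor <;> linarith
    | succ n ih =>
      intro x hx
      have h1 := b.abs_rhs_sub_le (hadm (n + 1)) (hadm n) (mul_nonneg (pow_nonneg hθ n) hc)
        (fun y hy => (ih y hy).1) (o₁ _ _) (fun y hy => (ih y hy).2) (o₂ _ _) hx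
      rw [e₁ (n + 1) x hx, e₂ (n + 1) x hx, e₁ n x hx, e₂ n x hx, pow_succ', mul_assoc b.θ]
      exact h1
  have hd₁ : ∀ x n, dist ((q n).1 x) ((q (n + 1)).1 x) ≤ c * b.A * b.θ ^ n := by
    intro x n
    rw [dist_comm, Real.dist_eq]
    by_cases hx : x ∈ G.Ω
    · linarith [(hstep n x hx).1]
    · rw [o₁ (n + 1) n x hx, sub_self, abs_zero]
      positivity
  have hd₂ : ∀ x n, dist ((q n).2 x) ((q (n + 1)).2 x) ≤ c * b.A * b.θ ^ n := by
    intro x n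
    rw [dist_comm, Real.dist_eq]
    by_cases hx : x ∈ G.Ω
    · have h1 := mul_le_mul_of_nonneg_left (b.le_A x) (mul_nonneg (pow_nonneg hθ n) hc)
      linarith [(hstep n x hx).2]
    · rw [o₂ (n + 1) n x hx, sub_self, abs_zero]
      positivity
  choose u hu using fun x => cauchySeq_tendsto_of_complete
    (cauchySeq_of_le_geometric _ _ b.θ_lt_one (hd₁ x))
  choose v hv using fun x => cauchySeq_tendsto_of_complete
    (cauchySeq_of_le_geometric _ _ b.θ_lt_one (hd₂ x))
  set d : ℕ → ℝ := fun n => c * b.A * b.θ ^ n / (1 - b.θ) with hd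
  have hd0 : ∀ n, 0 ≤ d n := fun n =>
    div_nonneg (by positivity) (sub_nonneg.2 b.θ_lt_one.le)
  have hdlim : Tendsto d atTop (𝓝 0) := by
    simpa using ((tendsto_pow_atTop_nhds_zero_of_lt_one hθ b.θ_lt_one).const_mul
      (c * b.A)).div_const (1 - b.θ)
  have hu' : ∀ n x, |(q n).1 x - u x| ≤ d n := fun n x =>
    dist_le_of_le_geometric_of_tendsto _ _ b.θ_lt_one (hd₁ x) (hu x) n
  have hv' : ∀ n x, |(q n).2 x - v x| ≤ d n := fun n x =>
    dist_le_of_le_geometric_of_tendsto _ _ b.θ_lt_one (hd₂ x) (hv x) n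
  have hext₁ : ∀ x ∉ G.Ω, u x = G.f x := fun x hx => tendsto_nhds_unique (hu x)
    (tendsto_const_nhds.congr fun n => ((hreg n).ext₁ x hx).symm)
  have hext₂ : ∀ x ∉ G.Ω, v x = G.g x := fun x hx => tendsto_nhds_unique (hv x)
    (tendsto_const_nhds.congr fun n => ((hreg n).ext₂ x hx).symm)
  have hR : G.IsRegular u v := by
    refine ⟨measurable_of_tendsto_metrizable (fun n => (hreg n).measurable₁)
      (tendsto_pi_nhds.2 hu), measurable_of_tendsto_metrizable (fun n => (hreg n).measurable₂)
      (tendsto_pi_nhds.2 hv), hext₁, hext₂, ?_⟩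
    obtain ⟨C, hC⟩ := (hreg 0).bounded
    refine ⟨C + d 0, fun x hx => ?_⟩
    have h1 := abs_sub_abs_le_abs_sub (u x) ((q 0).1 x)
    have h2 := abs_sub_abs_le_abs_sub (v x) ((q 0).2 x)
    rw [abs_sub_comm] at h1 h2
    constructor <;> linarith [hu' 0 x, hv' 0 x, (hC x hx).1, (hC x hx).2]
  have hrhs : ∀ n, ∀ x ∈ G.Ω, |(q (n + 1)).1 x - G.rhs₁ u v x| ≤ b.θ * d n * b.A ∧
      |(q (n + 1)).2 x - G.rhs₂ u v x| ≤ b.θ * d n * b.W x := by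
    intro n x hx
    rw [e₁ n x hx, e₂ n x hx]
    refine b.abs_rhs_sub_le (hadm n) (hR.admissible b) (hd0 n)
      (fun y _ => (hu' n y).trans (le_mul_of_one_le_right (hd0 n) hA1))
      (fun y hy => by rw [hext₁ y hy, (hreg n).ext₁ y hy])
      (fun y hy => (hv' n y).trans (le_mul_of_one_le_right (hd0 n) (b.one_le y (b.mem_ball hy))))
      (fun y hy => by rw [hext₂ y hy, (hreg n).ext₂ y hy]) hx
  have hlim : ∀ (s : ℕ → ℝ) (a B l : ℝ), (∀ n, |s (n + 1) - a| ≤ b.θ * d n * B) →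
      Tendsto s atTop (𝓝 l) → l = a := by
    intro s a B l h hl
    refine tendsto_nhds_unique (hl.comp (tendsto_add_atTop_nat 1)) ?_
    refine tendsto_iff_dist_tendsto_zero.2 (squeeze_zero (fun _ => dist_nonneg) h ?_)
    simpa using (hdlim.const_mul b.θ).mul_const B
  exact ⟨u, v, hR, hR.admissible b,
    fun x hx => hlim _ _ _ _ (fun n => (hrhs n x hx).1) (hu x),
    fun x hx => hlim _ _ _ _ (fun n => (hrhs n x hx).2) (hv x), hext₁, hext₂⟩

/-! ### Measurable near-optimal strategies -/

/-- A countable set of points that computes the suprema of `u` over all *open* balls of radius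
`r`, for an arbitrary `u`: by the Lindelöf property, for every rational `a` countably many of the
balls `B_r(y)` with `u y > a` cover the union of all of them. -/
theorem exists_seq_lt_of_mem_ball (u : Space N → ℝ) (r : ℝ) :
    ∃ d : ℕ → Space N, ∀ x, ∀ y ∈ ball x r, ∀ a < u y, ∃ n, d n ∈ ball x r ∧ a < u (d n) := by
  choose T hT hTc hTU using fun a : ℚ => TopologicalSpace.isOpen_biUnion_countable
    {y : Space N | (a : ℝ) < u y} (fun y => ball y r) fun _ _ => isOpen_ball
  obtain ⟨d, hd⟩ := ((countable_iUnion hTc).union (countable_singleton 0)).exists_eq_range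
    (⟨0, Or.inr rfl⟩ : ((⋃ a, T a) ∪ {(0 : Space N)}).Nonempty)
  refine ⟨d, fun x y hy a ha => ?_⟩
  obtain ⟨q, haq, hqy⟩ := exists_rat_btwn ha
  have hx : x ∈ ⋃ y ∈ {y : Space N | (q : ℝ) < u y}, ball y r :=
    mem_iUnion₂.2 ⟨y, hqy, mem_ball_comm.1 hy⟩
  rw [← hTU q] at hx
  obtain ⟨z, hz, hxz⟩ := mem_iUnion₂.1 hx
  have hzd : z ∈ range d := hd ▸ Or.inl (mem_iUnion.2 ⟨q, hz⟩)
  obtain ⟨n, rfl⟩ := hzd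
  have hqz : (q : ℝ) < u (d n) := hT q hz
  exact ⟨n, mem_ball_comm.1 hxz, haq.trans hqz⟩

open Classical in
theorem exists_measurable_selection {u : Space N → ℝ}
    (hu : ∀ x ∈ G.Ω, BddAbove (u '' ball x G.ε)) {η : ℝ} (hη : 0 < η) :
    ∃ φ : Space N → Space N, Measurable φ ∧ (∀ x, φ x ∈ ball x G.ε) ∧
      ∀ x ∈ G.Ω, sSup (u '' ball x G.ε) - η ≤ u (φ x) := by
  obtain ⟨d, hd⟩ := exists_seq_lt_of_mem_ball u G.ε
  let p : Space N → ℕ → Prop := fun x n =>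
    x ∈ G.Ω → d n ∈ ball x G.ε ∧ sSup (u '' ball x G.ε) - η < u (d n)
  have hp : ∀ x, ∃ n, p x n := by
    intro x
    by_cases hx : x ∈ G.Ω
    · obtain ⟨_, ⟨y, hy, rfl⟩, hlt⟩ := exists_lt_of_lt_csSup
        (Nonempty.image u ⟨x, mem_ball_self G.ε_pos⟩) (sub_lt_self _ hη)
      obtain ⟨n, hn⟩ := hd x y hy _ hlt
      exact ⟨n, fun _ => hn⟩
    · exact ⟨0, fun h => absurd h hx⟩
  have hmeas : ∀ k, MeasurableSet {x | p x k} := by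
    intro k
    have h1 : {x | p x k} = G.Ωᶜ ∪ (ball (d k) G.ε ∩ Subtype.val ''
        (G.Ω.domRestrict (fun x => sSup (u '' ball x G.ε)) ⁻¹' Iio (u (d k) + η))) := by
      ext x
      by_cases hx : x ∈ G.Ω
      · simp [p, hx, sub_lt_iff_lt_add, dist_comm]
      · simp [p, hx]
    rw [h1]
    exact G.isOpen_Ω.measurableSet.compl.union (measurableSet_ball.inter
      (G.isOpen_Ω.measurableSet.subtype_image
        (measurable_restrict_sSup hu measurableSet_Iio)))
  refine ⟨fun x => if x ∈ G.Ω then d (Nat.find (hp x)) else x, ?_, fun x => ?_, fun x hx => ?_⟩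
  · exact Measurable.ite G.isOpen_Ω.measurableSet
      ((measurable_of_countable d).comp (measurable_find hp hmeas)) measurable_id
  · by_cases hx : x ∈ G.Ω
    · simp only [hx, if_true]
      exact (Nat.find_spec (hp x) hx).1
    · simp only [hx, if_false]
      exact mem_ball_self G.ε_pos
  · simp only [hx, if_true]
    exact (Nat.find_spec (hp x) hx).2.le

/-- For an arbitrary function `u`, there is a strategy whose moves maximize `u` over the ball of
admissible moves, up to an error `η n` in round `n`. -/
theorem exists_nearMaximizing {u : Space N → ℝ}
    (hu : ∀ x ∈ G.Ω, BddAbove (u '' ball x G.ε)) {η : ℕ → ℝ} (hη : ∀ n, 0 < η n) :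
    ∃ S : G.Strategy, ∀ n (h : History N n), h.last.1 ∈ G.Ω →
      sSup (u '' ball h.last.1 G.ε) - η n ≤ u (S.move n h) := by
  choose φ hφm hφb hφ using fun n => exists_measurable_selection hu (hη n)
  refine ⟨⟨fun n h => φ n h.last.1, fun n => ?_, fun n h => hφb n _⟩, fun n h hx => hφ n _ hx⟩
  have hl : Measurable (fun h : History N n => h.last) := measurable_pi_apply _
  exact (hφm n).comp hl.fst

theorem exists_nearMinimizing {u : Space N → ℝ}
    (hu : ∀ x ∈ G.Ω, BddBelow (u '' ball x G.ε)) {η : ℕ → ℝ} (hη : ∀ n, 0 < η n) :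
    ∃ S : G.Strategy, ∀ n (h : History N n), h.last.1 ∈ G.Ω →
      u (S.move n h) ≤ sInf (u '' ball h.last.1 G.ε) + η n := by
  obtain ⟨S, hS⟩ := exists_nearMaximizing (fun x hx => bddAbove_neg_image (hu x hx)) hη
  refine ⟨S, fun n h hx => ?_⟩
  have := hS n h hx
  rw [sInf_image_eq]
  linarith

/-! ### One round of the game -/

theorem integrable_of_bounded {α : Type*} [MeasurableSpace α] (μ : Measure α) [IsFiniteMeasure μ]
    {F : α → ℝ} (hF : Measurable F) {C : ℝ} (hC : ∀ q, |F q| ≤ C) : Integrable F μ :=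
  Integrable.of_bound hF.aestronglyMeasurable C (ae_of_all _ hC)

theorem integral_step_tug {F : Pos N → ℝ} (hF : Measurable F) {C : ℝ} (hC : ∀ q, |F q| ≤ C)
    {p : Pos N} (hp : p.1 ∈ G.Ω) (h0 : p.2 = 0) (y₁ y₂ : Space N) :
    ∫ q, F q ∂(G.step p y₁ y₂) =
      (1 - G.ε ^ 2) / 2 * F (y₁, 0) + (1 - G.ε ^ 2) / 2 * F (y₂, 0) + G.ε ^ 2 * F (p.1, 1) := by
  have hq := G.one_sub_sq_pos
  have hi : ∀ (a : ℝ) (q : Pos N), Integrable F (ENNReal.ofReal a • Measure.dirac q) :=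
    fun a q => (integrable_of_bounded _ hF hC).smul_measure ENNReal.ofReal_ne_top
  rw [step, if_pos hp, if_pos h0, integral_add_measure ((hi _ _).add_measure (hi _ _)) (hi _ _),
    integral_add_measure (hi _ _) (hi _ _), integral_smul_measure, integral_smul_measure,
    integral_smul_measure, integral_dirac, integral_dirac, integral_dirac,
    ENNReal.toReal_ofReal (by positivity), ENNReal.toReal_ofReal (by positivity)]
  rfl

theorem integral_step_walk {F : Pos N → ℝ} (hF : Measurable F) {C : ℝ} (hC : ∀ q, |F q| ≤ C)
    {p : Pos N} (hp : p.1 ∈ G.Ω) (h1 : p.2 ≠ 0) (y₁ y₂ : Space N) :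
    ∫ q, F q ∂(G.step p y₁ y₂) =
      (1 - G.ε ^ 2) * (⨍ y in ball p.1 G.ε, F (y, 1)) + G.ε ^ 2 * F (p.1, 0) := by
  have hq := G.one_sub_sq_pos
  have := G.isProbabilityMeasure_uniform p.1
  rw [step, if_pos hp, if_neg h1, integral_add_measure
    ((integrable_of_bounded _ hF hC).smul_measure ENNReal.ofReal_ne_top)
    ((integrable_of_bounded _ hF hC).smul_measure ENNReal.ofReal_ne_top),
    integral_smul_measure, integral_smul_measure, integral_dirac,
    integral_map (by fun_prop) hF.aestronglyMeasurable,
    ENNReal.toReal_ofReal hq.le, ENNReal.toReal_ofReal (sq_nonneg _), setAverage_eq_integral_cond]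
  rfl

theorem integral_step_of_notMem (F : Pos N → ℝ) {p : Pos N} (hp : p.1 ∉ G.Ω) (y₁ y₂ : Space N) :
    ∫ q, F q ∂(G.step p y₁ y₂) = F p := by
  rw [step, if_neg hp, integral_dirac]

theorem Barrier.ae_step_mem_ball (b : G.Barrier) {p : Pos N} (hp : p.1 ∈ ball (0 : Space N) b.R)
    {y₁ y₂ : Space N} (h₁ : y₁ ∈ ball p.1 G.ε) (h₂ : y₂ ∈ ball p.1 G.ε) :
    ∀ᵐ q ∂(G.step p y₁ y₂), q.1 ∈ ball (0 : Space N) b.R := by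
  have hm : MeasurableSet {q : Pos N | q.1 ∈ ball (0 : Space N) b.R} :=
    measurableSet_ball.preimage measurable_fst
  have hd : ∀ q₀ : Pos N, q₀.1 ∈ ball (0 : Space N) b.R →
      ∀ᵐ q ∂(Measure.dirac q₀), q.1 ∈ ball (0 : Space N) b.R := fun q₀ h =>
    (ae_dirac_iff (p := fun q : Pos N => q.1 ∈ ball (0 : Space N) b.R) hm).2 h
  unfold step
  split_ifs with hΩ h0
  · have hs := b.ball_subset _ hΩ
    rw [ae_add_measure_iff, ae_add_measure_iff]
    exact ⟨⟨Measure.ae_smul_measure (hd (y₁, 0) (hs h₁)) _,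
      Measure.ae_smul_measure (hd (y₂, 0) (hs h₂)) _⟩,
      Measure.ae_smul_measure (hd (p.1, 1) hp) _⟩
  · have hs := b.ball_subset _ hΩ
    rw [ae_add_measure_iff]
    refine ⟨Measure.ae_smul_measure ((ae_map_iff (by fun_prop) hm).2 ?_) _,
      Measure.ae_smul_measure (hd (p.1, 0) hp) _⟩
    exact Measure.ae_smul_measure (ae_restrict_of_forall_mem measurableSet_ball fun y hy => hs hy) _
  · exact hd p hp

open Classical in
/-- The function on positions equal to `u` on the first board and to `v` on the second one, set to
`0` at the positions whose point is not in `s`. -/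
def glue (s : Set (Space N)) (u v : Space N → ℝ) (q : Pos N) : ℝ :=
  if q.1 ∈ s then if q.2 = 0 then u q.1 else v q.1 else 0

theorem measurable_glue {s : Set (Space N)} (hs : MeasurableSet s) {u v : Space N → ℝ}
    (hu : Measurable u) (hv : Measurable v) : Measurable (glue s u v) := by
  classical
  exact Measurable.ite (hs.preimage measurable_fst)
    (Measurable.ite ((measurableSet_singleton (0 : Fin 2)).preimage measurable_snd)
      (hu.comp measurable_fst) (hv.comp measurable_fst)) measurable_const

theorem glue_zero {s : Set (Space N)} {u v : Space N → ℝ} {x : Space N} (hx : x ∈ s) :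
    glue s u v (x, 0) = u x := by
  simp [glue, hx]

theorem glue_one {s : Set (Space N)} {u v : Space N → ℝ} {x : Space N} (hx : x ∈ s) :
    glue s u v (x, 1) = v x := by
  simp [glue, hx]

theorem glue_of_notMem {s : Set (Space N)} {u v : Space N → ℝ} {q : Pos N} (hx : q.1 ∉ s) :
    glue s u v q = 0 := by
  simp [glue, hx]

theorem abs_glue_le {s : Set (Space N)} {u v : Space N → ℝ} {C : ℝ} (hC0 : 0 ≤ C)
    (hC : ∀ x ∈ s, |u x| ≤ C ∧ |v x| ≤ C) (q : Pos N) : |glue s u v q| ≤ C := by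
  unfold glue
  split_ifs with h1 h2
  · exact (hC _ h1).1
  · exact (hC _ h1).2
  · simpa using hC0

theorem eq_mk_one {p : Pos N} (h : p.2 ≠ 0) : p = (p.1, 1) :=
  Prod.ext rfl (Fin.eq_one_of_ne_zero _ h)

theorem eq_mk_zero {p : Pos N} (h : p.2 = 0) : p = (p.1, 0) :=
  Prod.ext rfl h

/-! ### The law of the game -/

variable (S₁ S₂ : G.Strategy) (p : Pos N)

instance : IsProbabilityMeasure (G.law S₁ S₂ p) := by
  unfold law
  infer_instance

/-- The law of the first `n + 1` positions. -/
def historyLaw (n : ℕ) : Measure (History N n) :=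
  (G.law S₁ S₂ p).map (Preorder.frestrictLe n)

instance (n : ℕ) : IsProbabilityMeasure (historyLaw S₁ S₂ p n) :=
  Measure.isProbabilityMeasure_map (by fun_prop)

theorem historyLaw_compProd (n : ℕ) :
    historyLaw S₁ S₂ p n ⊗ₘ G.transition S₁ S₂ n =
      (G.law S₁ S₂ p).map fun ω => (Preorder.frestrictLe n ω, ω (n + 1)) := by
  rw [historyLaw, law, Kernel.traj_map_frestrictLe_apply]
  exact Kernel.partialTraj_compProd_eq_map_traj (X := fun _ => Pos N) (Nat.zero_le n)

theorem historyLaw_zero : historyLaw S₁ S₂ p 0 = Measure.dirac fun _ => p := by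
  rw [historyLaw, law, Kernel.traj_map_frestrictLe_apply, Kernel.partialTraj_self]
  rfl

theorem ae_law_of_ae_transition {n : ℕ} {P : History N n → Pos N → Prop}
    (hP : MeasurableSet {z : History N n × Pos N | P z.1 z.2})
    (h : ∀ k, ∀ᵐ q ∂(G.transition S₁ S₂ n k), P k q) :
    ∀ᵐ ω ∂(G.law S₁ S₂ p), P (Preorder.frestrictLe n ω) (ω (n + 1)) := by
  have h1 := (Measure.ae_compProd_iff (μ := historyLaw S₁ S₂ p n) hP).2 (ae_of_all _ h)
  rw [historyLaw_compProd] at h1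
  exact (ae_map_iff (by fun_prop) hP).1 h1

variable {S₁ S₂ p}

theorem integral_law_zero {F : Pos N → ℝ} (hF : Measurable F) :
    ∫ ω, F (ω 0) ∂(G.law S₁ S₂ p) = F p := by
  have hl : Measurable (fun h : History N 0 => h.last) := measurable_pi_apply _
  have h1 : ∫ h : History N 0, F h.last ∂(historyLaw S₁ S₂ p 0) =
      ∫ ω, F (ω 0) ∂(G.law S₁ S₂ p) :=
    integral_map (by fun_prop) (hF.comp hl).aestronglyMeasurable
  have h2 := integral_dirac' (fun h : History N 0 => F h.last) (fun _ => p)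
    (hF.comp hl).stronglyMeasurable
  rw [← h1, historyLaw_zero, h2]
  rfl

theorem integral_law_succ_le {F : Pos N → ℝ} (hF : Measurable F) {C : ℝ} (hC : ∀ q, |F q| ≤ C)
    {n : ℕ} {a e : ℝ}
    (h : ∀ k : History N n, ∫ q, F q ∂(G.transition S₁ S₂ n k) ≤ a * F k.last + e) :
    ∫ ω, F (ω (n + 1)) ∂(G.law S₁ S₂ p) ≤ a * ∫ ω, F (ω n) ∂(G.law S₁ S₂ p) + e := by
  have hl : Measurable (fun h : History N n => h.last) := measurable_pi_apply _
  have h1 : ∫ z : History N n × Pos N, F z.2 ∂(historyLaw S₁ S₂ p n ⊗ₘ G.transition S₁ S₂ n) =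
      ∫ ω, F (ω (n + 1)) ∂(G.law S₁ S₂ p) := by
    rw [historyLaw_compProd]
    exact integral_map (by fun_prop) (hF.comp measurable_snd).aestronglyMeasurable
  have h2 : ∫ k : History N n, F k.last ∂(historyLaw S₁ S₂ p n) =
      ∫ ω, F (ω n) ∂(G.law S₁ S₂ p) :=
    integral_map (by fun_prop) (hF.comp hl).aestronglyMeasurable
  have hi : Integrable (fun z : History N n × Pos N => F z.2)
      (historyLaw S₁ S₂ p n ⊗ₘ G.transition S₁ S₂ n) :=
    integrable_of_bounded _ (hF.comp measurable_snd) fun z => hC z.2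
  have hi' : Integrable (fun k : History N n => F k.last) (historyLaw S₁ S₂ p n) :=
    integrable_of_bounded _ (hF.comp hl) fun k => hC k.last
  rw [← h1, ← h2, Measure.integral_compProd hi]
  have hi'' : Integrable (fun k : History N n => a * F k.last + e) (historyLaw S₁ S₂ p n) :=
    (hi'.const_mul a).add (integrable_const e)
  have hκ : Integrable (fun k : History N n => ∫ q, F q ∂(G.transition S₁ S₂ n k))
      (historyLaw S₁ S₂ p n) :=
    integrable_of_bounded _ hF.stronglyMeasurable.integral_kernel.measurable (C := C) fun k => by
      simpa using norm_integral_le_of_norm_le_const (μ := G.transition S₁ S₂ n k)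
        (ae_of_all _ fun q => (Real.norm_eq_abs (F q)).trans_le (hC q))
  refine (integral_mono hκ hi'' h).trans (le_of_eq ?_)
  rw [integral_add (hi'.const_mul a) (integrable_const e), integral_const_mul, integral_const]
  simp

/-- Summing the errors `δ / 2 ^ (n + 1)` of the successive rounds. -/
theorem integral_law_le {F : Pos N → ℝ} (hF : Measurable F) {C : ℝ} (hC : ∀ q, |F q| ≤ C)
    {δ : ℝ} (hδ : 0 ≤ δ) (h : ∀ n (k : History N n),
      ∫ q, F q ∂(G.transition S₁ S₂ n k) ≤ F k.last + δ * (1 / 2) ^ (n + 1)) (n : ℕ) :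
    ∫ ω, F (ω n) ∂(G.law S₁ S₂ p) ≤ F p + δ := by
  have key : ∫ ω, F (ω n) ∂(G.law S₁ S₂ p) ≤ F p + δ * (1 - (1 / 2) ^ n) := by
    induction n with
    | zero => simp [integral_law_zero hF]
    | succ n ih =>
      have h1 := integral_law_succ_le (p := p) hF hC (a := 1) (e := δ * (1 / 2) ^ (n + 1))
        fun k => by simpa using h n k
      rw [one_mul] at h1
      refine h1.trans ((add_le_add_left ih _).trans (le_of_eq ?_))
      ring
  have : 0 ≤ δ * (1 / 2) ^ n := by positivity
  linarith

/-! ### The game ends almost surely -/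

theorem Barrier.integral_step_weight_le (b : G.Barrier) (p : Pos N) {y₁ y₂ : Space N} :
    ∫ q, glue G.Ω (fun _ => b.A) b.W q ∂(G.step p y₁ y₂)
      ≤ b.θ * glue G.Ω (fun _ => b.A) b.W p := by
  have hA0 : 0 ≤ b.A := zero_le_one.trans b.one_le_A
  have hm : Measurable (glue G.Ω (fun _ => b.A) b.W) :=
    measurable_glue G.isOpen_Ω.measurableSet measurable_const b.continuous_W.measurable
  have hW0 : ∀ x ∈ ball (0 : Space N) b.R, 0 ≤ b.W x := fun x hx =>
    zero_le_one.trans (b.one_le x hx)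
  have hbd : ∀ q, |glue G.Ω (fun _ => b.A) b.W q| ≤ b.A := abs_glue_le hA0 fun x hx =>
    ⟨(abs_of_nonneg hA0).le, by rw [abs_of_nonneg (hW0 x (b.mem_ball hx))]; exact b.le_A x⟩
  have hq := G.one_sub_sq_pos
  by_cases hp : p.1 ∈ G.Ω
  · by_cases h0 : p.2 = 0
    · rw [integral_step_tug hm hbd hp h0, eq_mk_zero h0, glue_zero hp, glue_one hp]
      have h1 := (abs_le.1 (hbd (y₁, 0))).2
      have h2 := (abs_le.1 (hbd (y₂, 0))).2
      nlinarith [b.tug_le _ hp]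
    · rw [integral_step_walk hm hbd hp h0, eq_mk_one h0, glue_zero hp, glue_one hp]
      have h1 : ⨍ y in ball p.1 G.ε, glue G.Ω (fun _ => b.A) b.W (y, 1)
          ≤ ⨍ y in ball p.1 G.ε, b.W y := by
        refine setAverage_le_setAverage measurableSet_ball ?_ (b.integrableOn_W _) fun y hy => ?_
        · exact Measure.integrableOn_of_bounded (M := b.A) measure_ball_lt_top.ne
            (hm.comp (by fun_prop)).aestronglyMeasurable (ae_of_all _ fun y => hbd (y, 1))
        · by_cases hyΩ : y ∈ G.Ω
          · rw [glue_one hyΩ]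
          · rw [glue_of_notMem (q := (y, 1)) hyΩ]
            exact hW0 y (b.ball_subset _ hp hy)
      have h2 := mul_le_mul_of_nonneg_left h1 hq.le
      linarith [b.walk_le _ hp]
  · rw [integral_step_of_notMem _ hp, glue_of_notMem hp, mul_zero]

theorem Barrier.ae_ends (b : G.Barrier) : ∀ᵐ ω ∂(G.law S₁ S₂ p), G.Ends ω := by
  set F := glue G.Ω (fun _ => b.A) b.W with hFdef
  have hA0 : 0 ≤ b.A := zero_le_one.trans b.one_le_A
  have hW0 : ∀ x ∈ G.Ω, 0 ≤ b.W x := fun x hx =>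
    zero_le_one.trans (b.one_le x (b.mem_ball hx))
  have hF : Measurable F :=
    measurable_glue G.isOpen_Ω.measurableSet measurable_const b.continuous_W.measurable
  have hbd : ∀ q, |F q| ≤ b.A := abs_glue_le hA0 fun x hx =>
    ⟨(abs_of_nonneg hA0).le, by rw [abs_of_nonneg (hW0 x hx)]; exact b.le_A x⟩
  have hdecay : ∀ n, ∫ ω, F (ω n) ∂(G.law S₁ S₂ p) ≤ b.θ ^ n * F p := by
    intro n
    induction n with
    | zero => simp [integral_law_zero hF]
    | succ n ih =>
      have h1 := integral_law_succ_le (S₁ := S₁) (S₂ := S₂) (p := p) (n := n) hF hbd (a := b.θ)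
        (e := 0) fun k => by
          rw [add_zero]
          exact b.integral_step_weight_le _
      rw [pow_succ', mul_assoc]
      linarith [mul_le_mul_of_nonneg_left ih b.θ_nonneg]
  have hprob : ∀ n, (G.law S₁ S₂ p).real {ω | ¬ G.Ends ω} ≤ b.θ ^ n * F p := by
    intro n
    refine le_trans ?_ (hdecay n)
    have hs : MeasurableSet {ω : ℕ → Pos N | (ω n).1 ∈ G.Ω} :=
      G.isOpen_Ω.measurableSet.preimage (by fun_prop)
    have h1 : (G.law S₁ S₂ p).real {ω | ¬ G.Ends ω}
        ≤ (G.law S₁ S₂ p).real {ω | (ω n).1 ∈ G.Ω} :=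
      measureReal_mono fun ω hω => by_contra fun h => hω ⟨n, h⟩
    refine h1.trans ?_
    rw [← integral_indicator_one hs]
    refine integral_mono ((integrable_const 1).indicator hs)
      (integrable_of_bounded _ (hF.comp (measurable_pi_apply n)) fun ω => hbd (ω n)) fun ω => ?_
    by_cases hω : (ω n).1 ∈ G.Ω
    · rw [indicator_of_mem (by exact hω)]
      by_cases h0 : (ω n).2 = 0
      · rw [hFdef, eq_mk_zero h0, glue_zero hω]
        exact b.one_le_A
      · rw [hFdef, eq_mk_one h0, glue_one hω]
        exact b.one_le _ (b.mem_ball hω)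
    · rw [indicator_of_notMem (by exact hω), hFdef, glue_of_notMem hω]
  have hlim : Tendsto (fun n => b.θ ^ n * F p) atTop (𝓝 0) := by
    simpa using (tendsto_pow_atTop_nhds_zero_of_lt_one b.θ_nonneg b.θ_lt_one).mul_const (F p)
  have h0 : (G.law S₁ S₂ p).real {ω | ¬ G.Ends ω} = 0 :=
    le_antisymm (ge_of_tendsto' hlim hprob) measureReal_nonneg
  rwa [measureReal_eq_zero_iff] at h0

theorem Barrier.ae_mem_ball (b : G.Barrier) (hp : p.1 ∈ ball (0 : Space N) b.R) :
    ∀ᵐ ω ∂(G.law S₁ S₂ p), ∀ n, (ω n).1 ∈ ball (0 : Space N) b.R := by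
  refine ae_all_iff.2 fun n => ?_
  induction n with
  | zero =>
    have hs : MeasurableSet {h : History N 0 | h.last.1 ∈ ball (0 : Space N) b.R} :=
      measurableSet_ball.preimage (measurable_pi_apply _).fst
    have h1 : ∀ᵐ h ∂(historyLaw S₁ S₂ p 0), h.last.1 ∈ ball (0 : Space N) b.R := by
      rw [historyLaw_zero]
      exact (ae_dirac_iff (p := fun h : History N 0 => h.last.1 ∈ ball (0 : Space N) b.R) hs).2 hp
    have h2 : ∀ᵐ ω ∂(G.law S₁ S₂ p), History.last (n := 0) (Preorder.frestrictLe 0 ω) ∈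
        Prod.fst ⁻¹' ball (0 : Space N) b.R :=
      ae_of_ae_map (p := fun h : History N 0 => h.last ∈ Prod.fst ⁻¹' ball (0 : Space N) b.R)
        (by fun_prop) h1
    exact h2
  | succ n ih =>
    have hl : Measurable (fun h : History N n => h.last) := measurable_pi_apply _
    have h1 := ae_law_of_ae_transition S₁ S₂ p (n := n)
      (P := fun k q => k.last.1 ∈ ball (0 : Space N) b.R → q.1 ∈ ball (0 : Space N) b.R)
      (MeasurableSet.imp (measurableSet_ball.preimage (hl.comp measurable_fst).fst)
        (measurableSet_ball.preimage measurable_snd.fst))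
      fun k => by
        by_cases hk : k.last.1 ∈ ball (0 : Space N) b.R
        · filter_upwards [b.ae_step_mem_ball hk (S₁.move_mem n k) (S₂.move_mem n k)] with q hq _
          exact hq
        · exact ae_of_all _ fun q h => absurd h hk
    filter_upwards [ih, h1] with ω h2 h3
    exact h3 h2

theorem ae_eq_of_notMem :
    ∀ᵐ ω ∂(G.law S₁ S₂ p), ∀ n, (ω n).1 ∉ G.Ω → ω (n + 1) = ω n := by
  refine ae_all_iff.2 fun n => ?_
  have hl : Measurable (fun h : History N n => h.last) := measurable_pi_apply _
  refine ae_law_of_ae_transition S₁ S₂ p (n := n)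
    (P := fun k q => k.last.1 ∉ G.Ω → q = k.last)
    (MeasurableSet.imp (G.isOpen_Ω.measurableSet.compl.preimage (hl.comp measurable_fst).fst)
      (measurableSet_eq_fun measurable_snd (hl.comp measurable_fst))) fun k => ?_
  by_cases hk : k.last.1 ∈ G.Ω
  · exact ae_of_all _ fun q h => absurd hk h
  · have h1 : G.transition S₁ S₂ n k = Measure.dirac k.last := if_neg hk
    rw [h1]
    filter_upwards [(ae_dirac_iff (measurableSet_singleton k.last)).2 rfl] with q hq _
    exact hq

/-- If `F` agrees with the final payoff at the positions where the game can end, its values along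
the (eventually constant) game sequence converge to the payoff. -/
theorem Barrier.ae_tendsto_payoff (b : G.Barrier) (hp : p.1 ∈ ball (0 : Space N) b.R)
    {F : Pos N → ℝ} (hF : ∀ q : Pos N, q.1 ∈ ball (0 : Space N) b.R → q.1 ∉ G.Ω →
      F q = G.terminal q) :
    ∀ᵐ ω ∂(G.law S₁ S₂ p), Tendsto (fun n => F (ω n)) atTop (𝓝 (G.payoff ω)) := by
  classical
  filter_upwards [b.ae_ends, b.ae_mem_ball hp, ae_eq_of_notMem] with ω hends hball hfixed
  have hfind : (ω (Nat.find hends)).1 ∉ G.Ω := Nat.find_spec hends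
  have hconst : ∀ n, Nat.find hends ≤ n → ω n = ω (Nat.find hends) := by
    intro n hn
    induction n, hn using Nat.le_induction with
    | base => rfl
    | succ n hn ih => rw [hfixed n (by rw [ih]; exact hfind), ih]
  have hpay : G.payoff ω = F (ω (Nat.find hends)) := by
    rw [hF _ (hball _) hfind, payoff, dif_pos hends]
  rw [hpay]
  refine tendsto_const_nhds.congr' ?_
  filter_upwards [eventually_ge_atTop (Nat.find hends)] with n hn
  rw [hconst n hn]

theorem Barrier.integrable_payoff_and_tendsto (b : G.Barrier)
    (hp : p.1 ∈ ball (0 : Space N) b.R) {F : Pos N → ℝ} (hFm : Measurable F) {C : ℝ}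
    (hC : ∀ q, |F q| ≤ C)
    (hF : ∀ q : Pos N, q.1 ∈ ball (0 : Space N) b.R → q.1 ∉ G.Ω → F q = G.terminal q) :
    Integrable G.payoff (G.law S₁ S₂ p) ∧
      Tendsto (fun n => ∫ ω, F (ω n) ∂(G.law S₁ S₂ p)) atTop (𝓝 (G.expectedPayoff S₁ S₂ p)) := by
  have hlim := b.ae_tendsto_payoff (S₁ := S₁) (S₂ := S₂) hp hF
  have hm : ∀ n, AEStronglyMeasurable (fun ω : ℕ → Pos N => F (ω n)) (G.law S₁ S₂ p) := fun n =>
    (hFm.comp (measurable_pi_apply n)).aestronglyMeasurable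
  constructor
  · refine Integrable.of_bound (aestronglyMeasurable_of_tendsto_ae atTop hm hlim) C ?_
    filter_upwards [hlim] with ω hω
    exact le_of_tendsto' hω.norm fun n => hC (ω n)
  · exact tendsto_integral_of_dominated_convergence (fun _ => C) hm (integrable_const C)
      (fun n => ae_of_all _ fun ω => hC (ω n)) hlim

/-! ### The value of the game -/

theorem expectedPayoff_comm (S₁ S₂ : G.Strategy) (p : Pos N) :
    G.expectedPayoff S₁ S₂ p = G.expectedPayoff S₂ S₁ p := by
  have hstep : ∀ (q : Pos N) (y₁ y₂ : Space N), G.step q y₁ y₂ = G.step q y₂ y₁ := by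
    intro q y₁ y₂
    unfold step
    rw [add_comm (ENNReal.ofReal ((1 - G.ε ^ 2) / 2) • Measure.dirac (y₁, (0 : Fin 2)))]
  have htrans : G.transition S₁ S₂ = G.transition S₂ S₁ := by
    funext n
    ext k : 1
    exact hstep _ _ _
  rw [expectedPayoff, expectedPayoff, law, law]
  congr! 3

/-- Since the two players have the same moves, it suffices that one player can keep the expected
payoff nearly below `a`, and nearly above `a`, against every strategy of the other. -/
theorem hasValueAt_of_nearOptimal {p : Pos N} {a : ℝ}
    (hle : ∀ δ > 0, ∃ S : G.Strategy, ∀ T, G.expectedPayoff S T p ≤ a + δ)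
    (hge : ∀ δ > 0, ∃ S : G.Strategy, ∀ T, a - δ ≤ G.expectedPayoff S T p) :
    G.HasValueAt p a := by
  have hle' : ∀ z : ℝ, (a : EReal) < z → ∃ S : G.Strategy, ∀ T, G.expectedPayoff S T p ≤ z := by
    intro z hz
    obtain ⟨S, hS⟩ := hle (z - a) (sub_pos.2 (EReal.coe_lt_coe_iff.1 hz))
    exact ⟨S, fun T => by linarith [hS T]⟩
  have hge' : ∀ z : ℝ, (z : EReal) < a → ∃ S : G.Strategy, ∀ T, z ≤ G.expectedPayoff S T p := by
    intro z hz
    obtain ⟨S, hS⟩ := hge (a - z) (sub_pos.2 (EReal.coe_lt_coe_iff.1 hz))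
    exact ⟨S, fun T => by linarith [hS T]⟩
  have hI : G.infSupI p = a := by
    refine le_antisymm (EReal.le_of_forall_lt_iff_le.1 fun z hz => ?_)
      (EReal.ge_of_forall_gt_iff_ge.1 fun z hz => ?_)
    · obtain ⟨S, hS⟩ := hle' z hz
      exact iInf_le_of_le S (iSup_le fun T => EReal.coe_le_coe_iff.2 (hS T))
    · obtain ⟨S, hS⟩ := hge' z hz
      refine le_iInf fun T => le_iSup_of_le S ?_
      rw [expectedPayoff_comm]
      exact EReal.coe_le_coe_iff.2 (hS T)
  have hII : G.supInfI p = a := by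
    refine le_antisymm (EReal.le_of_forall_lt_iff_le.1 fun z hz => ?_)
      (EReal.ge_of_forall_gt_iff_ge.1 fun z hz => ?_)
    · obtain ⟨S, hS⟩ := hle' z hz
      refine iSup_le fun T => iInf_le_of_le S ?_
      rw [expectedPayoff_comm]
      exact EReal.coe_le_coe_iff.2 (hS T)
    · obtain ⟨S, hS⟩ := hge' z hz
      exact le_iSup_of_le S (le_iInf fun T => EReal.coe_le_coe_iff.2 (hS T))
  refine ⟨hI, ?_, hII, ?_⟩
  · rw [← hII, supInfII, supInfI]
    exact iSup_congr fun S => iInf_congr fun T => by rw [expectedPayoff_comm]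
  · rw [← hI, infSupII, infSupI]
    exact iInf_congr fun S => iSup_congr fun T => by rw [expectedPayoff_comm]

theorem IsRegular.measurable_glue {u v : Space N → ℝ} (h : G.IsRegular u v) (r : ℝ) :
    Measurable (glue (ball 0 r) u v) :=
  GameData.measurable_glue measurableSet_ball h.measurable₁ h.measurable₂

theorem IsRegular.exists_abs_glue_le {u v : Space N → ℝ} (h : G.IsRegular u v) (r : ℝ) :
    ∃ C, ∀ q, |glue (ball 0 r) u v q| ≤ C := by
  obtain ⟨C, hC⟩ := h.exists_bound r
  exact ⟨|C|, abs_glue_le (abs_nonneg C) fun x hx =>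
    ⟨(hC x hx).1.trans (le_abs_self C), (hC x hx).2.trans (le_abs_self C)⟩⟩

theorem IsRegular.glue_eq_terminal {u v : Space N → ℝ} (h : G.IsRegular u v) {r : ℝ} {q : Pos N}
    (hq : q.1 ∈ ball (0 : Space N) r) (hΩ : q.1 ∉ G.Ω) : glue (ball 0 r) u v q = G.terminal q := by
  rw [glue, if_pos hq, terminal, h.ext₁ _ hΩ, h.ext₂ _ hΩ]

/-- For a solution of the dynamic programming principle, one round of the game changes the
expected value of the position only on the first board, and there by the mean of the two moves
minus the mean of the supremum and the infimum. -/
theorem Barrier.integral_step_solution (b : G.Barrier) {u v : Space N → ℝ}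
    (h : G.IsRegular u v) (h' : G.IsSolution u v) (p : Pos N) {y₁ y₂ : Space N}
    (hy₁ : y₁ ∈ ball p.1 G.ε) (hy₂ : y₂ ∈ ball p.1 G.ε) :
    (p.1 ∈ G.Ω ∧ ∫ q, glue (ball 0 b.R) u v q ∂(G.step p y₁ y₂) = glue (ball 0 b.R) u v p +
      (1 - G.ε ^ 2) / 2 * (u y₁ + u y₂ - sSup (u '' ball p.1 G.ε) - sInf (u '' ball p.1 G.ε))) ∨
    ∫ q, glue (ball 0 b.R) u v q ∂(G.step p y₁ y₂) = glue (ball 0 b.R) u v p := by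
  obtain ⟨C, hC⟩ := h.exists_abs_glue_le b.R
  by_cases hp : p.1 ∈ G.Ω
  · have hs := b.ball_subset _ hp
    have hpR := b.mem_ball hp
    by_cases h0 : p.2 = 0
    · left
      refine ⟨hp, ?_⟩
      rw [integral_step_tug (h.measurable_glue _) hC hp h0, eq_mk_zero h0, glue_zero hpR,
        glue_one hpR, glue_zero (hs hy₁), glue_zero (hs hy₂), h'.eq₁ _ hp]
      simp only [rhs₁]
      ring
    · right
      have h1 : ⨍ y in ball p.1 G.ε, glue (ball 0 b.R) u v (y, 1) = ⨍ y in ball p.1 G.ε, v y :=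
        setAverage_congr_fun measurableSet_ball (ae_of_all _ fun y hy => glue_one (hs hy))
      rw [integral_step_walk (h.measurable_glue _) hC hp h0, eq_mk_one h0, glue_zero hpR,
        glue_one hpR, h1, h'.eq₂ _ hp]
      simp only [rhs₂]
      ring
  · right
    exact integral_step_of_notMem _ hp _ _

theorem Barrier.hasValueAt (b : G.Barrier) {u v : Space N → ℝ} (h : G.IsRegular u v)
    (h' : G.IsSolution u v) {p : Pos N} (hp : p.1 ∈ ball (0 : Space N) b.R) :
    G.HasValueAt p (glue (ball 0 b.R) u v p) := by
  obtain ⟨C, hC⟩ := h.exists_abs_glue_le b.R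
  have hm := h.measurable_glue b.R
  have hε1 := G.one_sub_sq_pos
  have hε2 := sq_nonneg G.ε
  have hlim := fun S₁ S₂ : G.Strategy => (b.integrable_payoff_and_tendsto (S₁ := S₁) (S₂ := S₂)
    hp hm hC fun _ hq hΩ => h.glue_eq_terminal hq hΩ).2
  refine hasValueAt_of_nearOptimal (fun δ hδ => ?_) fun δ hδ => ?_
  · obtain ⟨S, hS⟩ := exists_nearMinimizing (fun x hx => (h'.admissible x hx).2.1)
      (η := fun n => δ * (1 / 2) ^ (n + 1)) fun n => by positivity
    refine ⟨S, fun T => le_of_tendsto' (hlim S T) (integral_law_le hm hC hδ.le fun n k => ?_)⟩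
    have hη : 0 < δ * (1 / 2 : ℝ) ^ (n + 1) := by positivity
    rcases b.integral_step_solution h h' k.last (S.move_mem n k) (T.move_mem n k) with
      ⟨hk, he⟩ | he
    · refine he.trans_le ?_
      have h1 := hS n k hk
      have h2 := le_csSup (h'.admissible _ hk).1 (mem_image_of_mem u (T.move_mem n k))
      nlinarith
    · exact he.trans_le (by linarith)
  · obtain ⟨S, hS⟩ := exists_nearMaximizing (fun x hx => (h'.admissible x hx).1)
      (η := fun n => δ * (1 / 2) ^ (n + 1)) fun n => by positivity
    refine ⟨S, fun T => ge_of_tendsto' (hlim S T) fun n => ?_⟩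
    have h1 := integral_law_le (S₁ := S) (S₂ := T) (p := p)
      (F := fun q => -glue (ball 0 b.R) u v q) hm.neg
      (fun q => (abs_neg _).trans_le (hC q)) hδ.le (fun n k => ?_) n
    · rw [integral_neg] at h1
      linarith
    have hη : 0 < δ * (1 / 2 : ℝ) ^ (n + 1) := by positivity
    rw [integral_neg]
    rcases b.integral_step_solution h h' k.last (S.move_mem n k) (T.move_mem n k) with
      ⟨hk, he⟩ | he
    · have he' : ∫ q, glue (ball 0 b.R) u v q ∂(G.transition S T n k) = _ := he
      rw [he']
      have h1 := hS n k hk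
      have h2 := csInf_le (h'.admissible _ hk).2.1 (mem_image_of_mem u (T.move_mem n k))
      nlinarith
    · have he' : ∫ q, glue (ball 0 b.R) u v q ∂(G.transition S T n k) = _ := he
      rw [he']
      linarith

end GameData

end TwoBoard

end

theorem theorem1p1 {N : ℕ} (hN : 1 ≤ N) (G : TwoBoard.GameData N) :
    -- the game ends almost surely and the expected payoff is well defined
    (∀ (S₁ S₂ : G.Strategy) (p : TwoBoard.Pos N), p.1 ∈ G.Ω →
      (∀ᵐ ω ∂(G.law S₁ S₂ p), G.Ends ω) ∧ Integrable G.payoff (G.law S₁ S₂ p)) ∧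
    ∃ u v : TwoBoard.Space N → ℝ,
      -- the game has the value `(u, v)`
      (∀ x ∈ G.Ω, G.HasValueAt (x, 0) (u x) ∧ G.HasValueAt (x, 1) (v x)) ∧
      -- which is bounded in `Ω` and solves the dynamic programming principle
      (∃ C : ℝ, ∀ x ∈ G.Ω, |u x| ≤ C ∧ |v x| ≤ C) ∧
      G.IsSolution u v ∧
      -- it is the only solution
      (∀ u' v' : TwoBoard.Space N → ℝ, G.IsSolution u' v' → u' = u ∧ v' = v) ∧
      -- and it is Perron's solution: the pointwise largest subsolution
      IsGreatest {q : (TwoBoard.Space N → ℝ) × (TwoBoard.Space N → ℝ) |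
        G.IsSubsolution q.1 q.2} (u, v) := by
  obtain ⟨b⟩ := G.exists_barrier hN
  obtain ⟨u, v, hreg, hsol⟩ := b.exists_isSolution
  obtain ⟨C, hC⟩ := hreg.exists_abs_glue_le b.R
  refine ⟨fun S₁ S₂ p hp => ⟨b.ae_ends, (b.integrable_payoff_and_tendsto (b.mem_ball hp)
    (hreg.measurable_glue _) hC fun _ hq hΩ => hreg.glue_eq_terminal hq hΩ).1⟩,
    u, v, fun x hx => ?_, hreg.bounded, hsol, fun u' v' h => ?_, hsol.isSubsolution, ?_⟩
  · have hxR := b.mem_ball hx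
    have h0 := b.hasValueAt hreg hsol (p := (x, 0)) hxR
    have h1 := b.hasValueAt hreg hsol (p := (x, 1)) hxR
    rw [TwoBoard.GameData.glue_zero hxR] at h0
    rw [TwoBoard.GameData.glue_one hxR] at h1
    exact ⟨h0, h1⟩
  · obtain ⟨h1, h2⟩ := h.isSubsolution.le_solution b hsol
    obtain ⟨h3, h4⟩ := hsol.isSubsolution.le_solution b h
    exact ⟨funext fun x => le_antisymm (h1 x) (h3 x), funext fun x => le_antisymm (h2 x) (h4 x)⟩
  · rintro ⟨z, w⟩ h
    exact h.le_solution b hsol
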